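/- All graphs and hypergraphs are finite; graphs are simple; the hyperedges of a hypergraph form a multiset of subsets of its vertex set (empty hyperedges allowed). Fix $t\in\mathbb N$. A *$t$-boundaried* hypergraph carries the labels $1,\dots,t$ on $t$ distinct objects (vertices or hyperedges), which form its boundary $\partial(H)$; $\mathcal H^{\text{large}}_t$ is the class of all of them. Two of them are *gluable* if no label sits on a vertex in one and on a hyperedge in the other; then $H_1\oplus H_2$ is obtained from the disjoint union by identifying vertices with equal labels and replacing hyperedges with equal labels by their union. Isomorphism of hypergraphs ignores labels and respects multiplicities of hyperedges. A *$\{1,2\}$-colored $t$-boundaried graph* is a graph with vertices colored $1$ or $2$ and with labels $1,\dots,t$ on $t$ distinct vertices. Two of them are *color-compatible* if vertices with equal labels have equal colors; then $G_1\oplus G_2$ is the disjoint union with vertices of equal label identified. $G$ is *well-colored* if each color class is independent; then $\mathcal H(G)$ is the $t$-boundaried hypergraph with the color-1 vertices of $G$ as vertices and the multiset $\{N(w) : w \text{ of color } 2\}$ as hyperedges, with inherited labels. $\mathcal U_t$ (the *small universe*) consists of the colored $t$-boundaried graphs that are, up to renaming vertices, values of expressions (*parse trees*) over the operators: $\varnothing_{n_1,n_2}$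 with $n_1+n_2=t$ (isolated vertices labeled $1,\dots,t$, the first $n_1$ of color 1, the others of color 2); $e$ (add an edge between the vertices labeled 1 and 2); $u_1,u_2$ ($u_\ell$ adds an isolated vertex of color $\ell$ that takes over label 1); $\gamma$ (cyclic shift of the labels); $i$ (swap labels 1 and 2); and $\oplus$. For a set $F\subseteq\mathcal U_t$ of well-colored graphs, $\mathcal H(F)$ is the set of the hypergraphs $\mathcal H(G)$, $G\in F$ (up to the names of vertices and hyperedges), and $F$ is *generator-total* if every well-colored $G\in\mathcal U_t$ with $\mathcal H(G)\in\mathcal H(F)$ lies in $F$. $\mathcal H^{\text{small}}_t$ is the set of all $\mathcal H(G)$ with $G\in\mathcal U_t$ well-colored. For a set $\mathcal P$ of boundaried objects and a universe $\mathcal U$ of such objects, $X_1\sim_{\mathcal P}X_2$ over $\mathcal U$ means: $X_1,X_2\in\mathcal U$ are gluable (color-compatible, for graphs), and for all $Y\in\mathcal U$ that are gluable to (color-compatible with) both, $X_1\oplus Y\in\mathcal P\iff X_2\oplus Y\in\mathcal P$. The index is the number of equivalence classes. **Statement.** Let $\mathcal F\subseteq\mathcal H^{\text{large}}_t$ be closed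 under isomorphism, and let $\mathcal F_t\subseteq\mathcal F$ be the set of all $H\in\mathcal F$ whose incidence graph has a tree decomposition of width $t-1$ in which $\partial(H)$ is a bag. Suppose that $\sim_{\mathcal F_t}$ has infinite index over $\mathcal H^{\text{large}}_t$. Then: 1. for the generator-total set $F\subseteq\mathcal U_t$ of well-colored graphs with $\mathcal H(F)=\mathcal F\cap\mathcal H^{\text{small}}_t$, the relation $\sim_F$ has infinite index over $\mathcal U_t$, and no finite tree automaton over the alphabet of the operators recognizes the set of parse trees of graphs in $F$; 2. no finite tree automaton decides $\mathcal F$ on incidence-graph parse trees: there is none that, for every $H\in\mathcal H^{\text{large}}_t$ and every parse tree $T$ of the two-colored $t$-boundaried incidence graph of $H$ (vertices of color 1, hyperedges of color 2, labels as in $H$), accepts $T$ if and only if $H\in\mathcal F$. -/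

import Mathlib

namespace BoundariedHypergraphs

/-! ### Gluing sets along a partial matching -/

/-- The disjoint union of `A` and `B` in which `a` and `b` are identified whenever `R a b`. -/
def Glued {A B : Type} (R : A → B → Prop) : Type :=
  Quot (fun x y : A ⊕ B => ∃ a b, R a b ∧ x = Sum.inl a ∧ y = Sum.inr b)

namespace Glued

variable {A B : Type} {R : A → B → Prop}

/-- The map from the left part. -/
def inl (a : A) : Glued R := Quot.mk _ (Sum.inl a)

/-- The map from the right part. -/
def inr (b : B) : Glued R := Quot.mk _ (Sum.inr b)

theorem inl_injective (hR : ∀ a a' b, R a b → R a' b → a = a') :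
    Function.Injective (inl : A → Glued R) := by
  intro a a' h
  let f : A ⊕ B → Set A := Sum.elim (fun a => {a}) (fun b => {a | R a b})
  have hf : ∀ x y : A ⊕ B, (∃ a b, R a b ∧ x = Sum.inl a ∧ y = Sum.inr b) → f x = f y := by
    rintro _ _ ⟨a, b, hab, rfl, rfl⟩
    ext c
    exact ⟨fun hc => by cases hc; exact hab, fun hc => hR c a b hc hab⟩
  have h2 : ({a} : Set A) = {a'} := congrArg (Quot.lift f hf) h
  exact Set.singleton_injective h2

instance [Finite A] [Finite B] : Finite (Glued R) :=
  inferInstanceAs (Finite (Quot _))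

end Glued

/-! ### Two-colored boundaried graphs -/

/-- The two vertex colors: `vert` is color 1 (the vertices of the represented hypergraph),
`edge` is color 2 (its hyperedges). -/
inductive Color : Type
  | vert
  | edge

/-- A finite `{1, 2}`-colored `t`-boundaried graph: `lab j` is the boundary vertex with label `j`
(labels are counted from `0`, so the label `j + 1` of the usual numbering is `j`). -/
structure BGraph (t : ℕ) where
  V : Type
  finV : Finite V
  graph : SimpleGraph V
  color : V → Color
  lab : Fin t ↪ V

attribute [instance] BGraph.finV

namespace BGraph

variable {t : ℕ}

/-- Boundary vertices with the same label have the same color. -/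
def ColorCompatible (G₁ G₂ : BGraph t) : Prop :=
  ∀ j, G₁.color (G₁.lab j) = G₂.color (G₂.lab j)

/-- The vertices of `G₁` and `G₂` carrying the same label. -/
def SameLabel (G₁ G₂ : BGraph t) (v : G₁.V) (w : G₂.V) : Prop :=
  ∃ j, G₁.lab j = v ∧ G₂.lab j = w

theorem SameLabel.left_unique (G₁ G₂ : BGraph t) (v v' : G₁.V) (w : G₂.V)
    (h : SameLabel G₁ G₂ v w) (h' : SameLabel G₁ G₂ v' w) : v = v' := by
  obtain ⟨j, rfl, rfl⟩ := h
  obtain ⟨k, rfl, hk⟩ := h'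
  rw [G₂.lab.injective hk]

/-- The glued graph: the disjoint union, with boundary vertices of the same label identified. -/
def glue (G₁ G₂ : BGraph t) (h : ColorCompatible G₁ G₂) : BGraph t where
  V := Glued (SameLabel G₁ G₂)
  finV := inferInstance
  graph := G₁.graph.map Glued.inl ⊔ G₂.graph.map Glued.inr
  color := Quot.lift (Sum.elim G₁.color G₂.color) (by
    rintro _ _ ⟨_, _, ⟨j, rfl, rfl⟩, rfl, rfl⟩
    exact h j)
  lab := G₁.lab.trans ⟨Glued.inl, Glued.inl_injective (SameLabel.left_unique G₁ G₂)⟩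

/-- `G₁` and `G₂` are the same colored boundaried graph up to the names of the vertices:
there is an isomorphism preserving colors and labels. -/
def LabeledIso (G₁ G₂ : BGraph t) : Prop :=
  ∃ f : G₁.graph ≃g G₂.graph,
    (∀ v, G₂.color (f v) = G₁.color v) ∧ ∀ j, f (G₁.lab j) = G₂.lab j

/-- Each color class is an independent set. -/
def WellColored (G : BGraph t) : Prop :=
  ∀ v w, G.graph.Adj v w → G.color v ≠ G.color w

/-! The parsing operators. -/

/-- `∅_{k, t - k}`: isolated boundary vertices, the first `k` of color 1, the others of color 2. -/
def empty (t : ℕ) (k : Fin (t + 1)) : BGraph t where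
  V := Fin t
  finV := inferInstance
  graph := ⊥
  color := fun j => if j.val < k.val then Color.vert else Color.edge
  lab := Function.Embedding.refl _

/-- `e`: add an edge between the first two boundary vertices. -/
def addEdge (ht : 2 ≤ t) (G : BGraph t) : BGraph t where
  V := G.V
  finV := G.finV
  graph := G.graph ⊔ SimpleGraph.edge (G.lab ⟨0, by omega⟩) (G.lab ⟨1, by omega⟩)
  color := G.color
  lab := G.lab

/-- `u_ℓ`: add a new isolated vertex of color `ℓ`, which takes over the first label. -/
def newVertex (ht : 1 ≤ t) (l : Color) (G : BGraph t) : BGraph t where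
  V := Option G.V
  finV := inferInstance
  graph := G.graph.map Function.Embedding.some
  color := fun v => v.elim l G.color
  lab := ⟨fun j => if j = ⟨0, by omega⟩ then none else some (G.lab j), by
    intro j k hjk
    by_cases hj : j = ⟨0, by omega⟩ <;> by_cases hk : k = ⟨0, by omega⟩ <;> simp_all⟩

/-- For a permutation `σ` of the labels, move each label `j` to the vertex with label `σ j`. -/
def relabel (σ : Equiv.Perm (Fin t)) (G : BGraph t) : BGraph t where
  V := G.V
  finV := G.finV
  graph := G.graph
  color := G.color
  lab := σ.toEmbedding.trans G.lab

end BGraph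

/-! ### Parse trees and their values -/

/-- The size-`t` parsing operators for two colors, used as an alphabet. -/
inductive Op (t : ℕ) : Type
  | empty (k : Fin (t + 1))
  | e
  | u (l : Color)
  | gamma
  | i
  | glue

/-- Rooted binary trees with nodes labeled by letters from `S`
(every node has zero, one or two children). -/
inductive BinTree (S : Type) : Type
  | leaf (a : S)
  | one (a : S) (x : BinTree S)
  | two (a : S) (x y : BinTree S)

/-- The value of an expression over the parsing operators; `none` if some operator has the
wrong number of arguments or is not defined on its arguments (gluing of color-incompatible graphs,
or a label that does not exist because `t` is too small). -/
noncomputable def eval {t : ℕ} : BinTree (Op t) → Option (BGraph t)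
  | .leaf (.empty k) => some (BGraph.empty t k)
  | .one .e x =>
    (eval x).bind fun G => if ht : 2 ≤ t then some (G.addEdge ht) else none
  | .one (.u l) x =>
    (eval x).bind fun G => if ht : 1 ≤ t then some (G.newVertex ht l) else none
  | .one .gamma x =>
    (eval x).map fun G => G.relabel (finRotate t)
  | .one .i x =>
    (eval x).bind fun G =>
      if ht : 2 ≤ t then some (G.relabel (Equiv.swap ⟨0, by omega⟩ ⟨1, by omega⟩)) else none
  | .two .glue x y =>
    (eval x).bind fun G₁ => (eval y).bind fun G₂ =>
      open Classical in
      if h : G₁.ColorCompatible G₂ then some (G₁.glue G₂ h) else none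
  | _ => none

/-- `T` is a parse tree of `G`: its value is `G`, up to the names of the vertices. -/
def Generates {t : ℕ} (T : BinTree (Op t)) (G : BGraph t) : Prop :=
  ∃ G', eval T = some G' ∧ G'.LabeledIso G

/-- The small universe of graphs: those generated by the parsing operators. -/
def USmall (t : ℕ) : Set (BGraph t) := {G | ∃ T, Generates T G}

/-- The canonical right congruence of `F` over a universe `U`. -/
def graphCongruence {t : ℕ} (F U : Set (BGraph t)) : Setoid U where
  r G₁ G₂ := G₁.1.ColorCompatible G₂.1 ∧
    ∀ H ∈ U, ∀ (h₁ : G₁.1.ColorCompatible H) (h₂ : G₂.1.ColorCompatible H),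
      (G₁.1.glue H h₁ ∈ F ↔ G₂.1.glue H h₂ ∈ F)
  iseqv :=
    { refl := fun _ => ⟨fun _ => rfl, fun _ _ _ _ => Iff.rfl⟩
      symm := fun h => ⟨fun j => (h.1 j).symm, fun H hH h₁ h₂ => (h.2 H hH h₂ h₁).symm⟩
      trans := fun h h' => ⟨fun j => (h.1 j).trans (h'.1 j), fun H hH h₁ h₂ =>
        (h.2 H hH h₁ (fun j => (h.1 j).symm.trans (h₁ j))).trans
          (h'.2 H hH (fun j => (h.1 j).symm.trans (h₁ j)) h₂)⟩ }

/-! ### Boundaried hypergraphs -/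

/-- A finite `t`-boundaried hypergraph. The hyperedges form a multiset: `E` indexes them, and
`mem v e` says that the vertex `v` belongs to the hyperedge `e`. `lab j` is the boundary object
(vertex or hyperedge) with label `j`. -/
structure BHypergraph (t : ℕ) where
  V : Type
  E : Type
  finV : Finite V
  finE : Finite E
  mem : V → E → Prop
  lab : Fin t ↪ V ⊕ E

attribute [instance] BHypergraph.finV BHypergraph.finE

namespace BHypergraph

variable {t : ℕ}

/-- No vertex of one hypergraph has the label of a hyperedge of the other. -/
def Gluable (H₁ H₂ : BHypergraph t) : Prop :=
  ∀ j, (H₁.lab j).isLeft = (H₂.lab j).isLeft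

def SameLabelV (H₁ H₂ : BHypergraph t) (v : H₁.V) (w : H₂.V) : Prop :=
  ∃ j, H₁.lab j = Sum.inl v ∧ H₂.lab j = Sum.inl w

def SameLabelE (H₁ H₂ : BHypergraph t) (e : H₁.E) (f : H₂.E) : Prop :=
  ∃ j, H₁.lab j = Sum.inr e ∧ H₂.lab j = Sum.inr f

theorem inlV_injective (H₁ H₂ : BHypergraph t) :
    Function.Injective (Glued.inl : H₁.V → Glued (SameLabelV H₁ H₂)) := by
  apply Glued.inl_injective
  rintro a a' b ⟨j, hj, hj'⟩ ⟨k, hk, hk'⟩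
  obtain rfl := H₂.lab.injective (hj'.trans hk'.symm)
  exact Sum.inl_injective (hj.symm.trans hk)

theorem inlE_injective (H₁ H₂ : BHypergraph t) :
    Function.Injective (Glued.inl : H₁.E → Glued (SameLabelE H₁ H₂)) := by
  apply Glued.inl_injective
  rintro a a' b ⟨j, hj, hj'⟩ ⟨k, hk, hk'⟩
  obtain rfl := H₂.lab.injective (hj'.trans hk'.symm)
  exact Sum.inr_injective (hj.symm.trans hk)

/-- The glued hypergraph: the disjoint union, with vertices of the same label identified and
hyperedges of the same label replaced by their union. -/
def glue (H₁ H₂ : BHypergraph t) (_h : Gluable H₁ H₂) : BHypergraph t where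
  V := Glued (SameLabelV H₁ H₂)
  E := Glued (SameLabelE H₁ H₂)
  finV := inferInstance
  finE := inferInstance
  mem v e :=
    (∃ v₁ e₁, H₁.mem v₁ e₁ ∧ v = Glued.inl v₁ ∧ e = Glued.inl e₁) ∨
    (∃ v₂ e₂, H₂.mem v₂ e₂ ∧ v = Glued.inr v₂ ∧ e = Glued.inr e₂)
  lab := H₁.lab.trans ⟨Sum.map Glued.inl Glued.inl,
    (inlV_injective H₁ H₂).sumMap (inlE_injective H₁ H₂)⟩

/-- Hypergraph isomorphism (labels are ignored, multiplicities of hyperedges are respected). -/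
def Iso (H₁ H₂ : BHypergraph t) : Prop :=
  ∃ (f : H₁.V ≃ H₂.V) (g : H₁.E ≃ H₂.E), ∀ v e, H₂.mem (f v) (g e) ↔ H₁.mem v e

/-- `H₁` and `H₂` are the same boundaried hypergraph up to names: there is an isomorphism that
preserves labels. -/
def LabeledIso (H₁ H₂ : BHypergraph t) : Prop :=
  ∃ (f : H₁.V ≃ H₂.V) (g : H₁.E ≃ H₂.E), (∀ v e, H₂.mem (f v) (g e) ↔ H₁.mem v e) ∧
    ∀ j, Sum.map f g (H₁.lab j) = H₂.lab j

/-- A hypergraph problem that is closed under isomorphism. -/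
def IsoClosed (P : Set (BHypergraph t)) : Prop :=
  ∀ H₁ H₂ : BHypergraph t, H₁.Iso H₂ → (H₁ ∈ P ↔ H₂ ∈ P)

/-- The incidence graph. -/
def incidenceGraph (H : BHypergraph t) : SimpleGraph (H.V ⊕ H.E) where
  Adj x y := (∃ v e, H.mem v e ∧ x = Sum.inl v ∧ y = Sum.inr e) ∨
    (∃ v e, H.mem v e ∧ y = Sum.inl v ∧ x = Sum.inr e)
  symm := ⟨fun _ _ h => h.symm⟩
  loopless := ⟨by rintro x (⟨v, e, -, h, h'⟩ | ⟨v, e, -, h, h'⟩) <;> simp [h] at h'⟩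

/-- The boundary, as a set of vertices of the incidence graph. -/
def boundary (H : BHypergraph t) : Set (H.V ⊕ H.E) := Set.range H.lab

/-- The incidence graph as a two-colored boundaried graph. -/
def coloredIncidenceGraph (H : BHypergraph t) : BGraph t where
  V := H.V ⊕ H.E
  finV := inferInstance
  graph := H.incidenceGraph
  color := Sum.elim (fun _ => Color.vert) (fun _ => Color.edge)
  lab := H.lab

end BHypergraph

/-- The canonical right congruence of a hypergraph problem `P` over a universe `U`. -/
def hypergraphCongruence {t : ℕ} (P U : Set (BHypergraph t)) : Setoid U where
  r H₁ H₂ := H₁.1.Gluable H₂.1 ∧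
    ∀ H ∈ U, ∀ (h₁ : H₁.1.Gluable H) (h₂ : H₂.1.Gluable H),
      (H₁.1.glue H h₁ ∈ P ↔ H₂.1.glue H h₂ ∈ P)
  iseqv :=
    { refl := fun _ => ⟨fun _ => rfl, fun _ _ _ _ => Iff.rfl⟩
      symm := fun h => ⟨fun j => (h.1 j).symm, fun H hH h₁ h₂ => (h.2 H hH h₂ h₁).symm⟩
      trans := fun h h' => ⟨fun j => (h.1 j).trans (h'.1 j), fun H hH h₁ h₂ =>
        (h.2 H hH h₁ (fun j => (h.1 j).symm.trans (h₁ j))).trans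
          (h'.2 H hH (fun j => (h.1 j).symm.trans (h₁ j)) h₂)⟩ }

/-- The number of equivalence classes is infinite. -/
def InfiniteIndex {X : Type 1} (s : Setoid X) : Prop := Infinite (Quotient s)

/-- The large universe: all `t`-boundaried hypergraphs. -/
def HLarge (t : ℕ) : Set (BHypergraph t) := Set.univ

/-! ### The hypergraph represented by a well-colored graph -/

/-- The hypergraph of a well-colored graph `G`: its vertices are the vertices of color 1, and each
vertex `w` of color 2 yields the hyperedge `N(w)`; labels are inherited. -/
def BGraph.toHypergraph {t : ℕ} (G : BGraph t) : BHypergraph t where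
  V := {v : G.V // G.color v = Color.vert}
  E := {w : G.V // G.color w = Color.edge}
  finV := inferInstance
  finE := inferInstance
  mem v w := G.graph.Adj w.1 v.1
  lab := ⟨fun j => match h : G.color (G.lab j) with
      | Color.vert => Sum.inl ⟨G.lab j, h⟩
      | Color.edge => Sum.inr ⟨G.lab j, h⟩, by
    intro j k hjk
    apply G.lab.injective
    dsimp only at hjk
    split at hjk <;> split at hjk <;> simp_all⟩

/-- The hypergraphs (up to the names of vertices and hyperedges) represented by a set of
well-colored graphs. -/
def hypergraphsOf {t : ℕ} (F : Set (BGraph t)) : Set (BHypergraph t) :=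
  {H | ∃ G ∈ F, G.toHypergraph.LabeledIso H}

/-- The well-colored graphs in the small universe. -/
def WCSmall (t : ℕ) : Set (BGraph t) := {G | G ∈ USmall t ∧ G.WellColored}

/-- The small universe of hypergraphs. -/
def HSmall (t : ℕ) : Set (BHypergraph t) := hypergraphsOf (WCSmall t)

/-- `F` contains every well-colored graph of the small universe that represents one of the
hypergraphs represented by `F`. -/
def GeneratorTotal {t : ℕ} (F : Set (BGraph t)) : Prop :=
  ∀ G ∈ WCSmall t, G.toHypergraph ∈ hypergraphsOf F → G ∈ F

/-! ### Tree decompositions -/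

/-- A tree decomposition of a graph. -/
structure TreeDecomposition {V : Type} (G : SimpleGraph V) where
  Node : Type
  finNode : Finite Node
  tree : SimpleGraph Node
  isTree : tree.IsTree
  root : Node
  bag : Node → Set V
  vertex_mem : ∀ v, ∃ x, v ∈ bag x
  edge_mem : ∀ u w, G.Adj u w → ∃ x, u ∈ bag x ∧ w ∈ bag x
  subtree : ∀ v, (tree.induce {x | v ∈ bag x}).Connected

/-- The size of the largest bag minus one. -/
noncomputable def TreeDecomposition.width {V : Type} {G : SimpleGraph V}
    (D : TreeDecomposition G) : ℤ :=
  ((⨆ x, (D.bag x).ncard : ℕ) : ℤ) - 1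

/-- The members of `P` whose incidence graph has a tree decomposition of width `t - 1` in which
the boundary is a bag. -/
def boundaryBagPart {t : ℕ} (P : Set (BHypergraph t)) : Set (BHypergraph t) :=
  {H | H ∈ P ∧ ∃ D : TreeDecomposition H.incidenceGraph,
    D.width = (t : ℤ) - 1 ∧ ∃ x, D.bag x = H.boundary}

/-! ### Tree automata -/

/-- Deterministic leaf-to-root finite tree automata over the alphabet `S`. -/
structure TreeAutomaton (S : Type) where
  Q : Type
  finQ : Finite Q
  δ₁ : S → Q → Q
  δ₂ : S → Q → Q → Q
  start : Q
  final : Set Q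

namespace TreeAutomaton

variable {S : Type}

/-- The state at the root. -/
def run (A : TreeAutomaton S) : BinTree S → A.Q
  | .leaf a => A.δ₁ a A.start
  | .one a x => A.δ₁ a (A.run x)
  | .two a x y => A.δ₂ a (A.run x) (A.run y)

def Accepts (A : TreeAutomaton S) (T : BinTree S) : Prop := A.run T ∈ A.final

def Recognizes (A : TreeAutomaton S) (L : Set (BinTree S)) : Prop :=
  ∀ T, A.Accepts T ↔ T ∈ L

end TreeAutomaton

/-- `A` decides the hypergraph problem `P` when it is fed parse trees of incidence graphs. -/
def TreeAutomaton.Decides {t : ℕ} (A : TreeAutomaton (Op t)) (P : Set (BHypergraph t)) : Prop :=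
  ∀ (H : BHypergraph t) (T : BinTree (Op t)),
    Generates T H.coloredIncidenceGraph → (A.Accepts T ↔ H ∈ P)

end BoundariedHypergraphs

open BoundariedHypergraphs

/-! The small universe has a structural description: a colored boundaried graph is the value of an
expression iff it has a tree decomposition with bags of size at most `t` in which the boundary is a
bag (`mem_USmall_iff`). Hence `boundaryBagPart P` consists of the members of `P` whose colored
incidence graph lies in the small universe (`mem_boundaryBagPart_iff`).

This property passes through gluing in both directions. Decompositions of the two sides can be
joined at the common boundary bag, and a decomposition of the glued graph restricts to each side
(`mem_USmall_glue_iff`). So a hypergraph outside the small universe never enters `boundaryBagPart P`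
by gluing, and all such hypergraphs with the same pattern of vertex and hyperedge labels are
equivalent. Only finitely many classes arise there, and infinite index must come from small
hypergraphs tested against small hypergraphs (`finite_quotient_hypergraphCongruence`).

On those, forming incidence graphs commutes with gluing (`glue_coloredIncidenceGraph_iso`).
Therefore the class of the incidence graph under the congruence of `F`, or the state that a deciding
automaton reaches on a parse tree of it, determines the behavior under gluing. Finite index of that
congruence, or an automaton, would leave only finitely many classes. An automaton for the parse
trees of `F` would in turn give the congruence of `F` finite index, by the same state argument.

The two directions of the structural description meet in `BagTree`, which normalizes a
decomposition: all bags have the size of the root bag, and each new bag exchanges one vertex, just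
as a `u` operator does. -/

namespace BoundariedHypergraphs

/-! ### Expressions for graphs on subsets of a fixed colored vertex set -/

section Realization

variable {t : ℕ} {V : Type} {c : V → Color}

/-- Some expression has a value that embeds into the colored set `V` with vertex set `W`,
edges `E`, and labels `l`. -/
def Realizes (c : V → Color) (W : Set V) (E : SimpleGraph V) (l : Fin t → V) : Prop :=
  ∃ (T : BinTree (Op t)) (G : BGraph t) (f : G.V → V), eval T = some G ∧ Function.Injective f ∧
    Set.range f = W ∧ (∀ x y, E.Adj x y ↔ ∃ a b, G.graph.Adj a b ∧ f a = x ∧ f b = y) ∧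
    (∀ a, c (f a) = G.color a) ∧ ∀ j, f (G.lab j) = l j

theorem Realizes.injective {W : Set V} {E : SimpleGraph V} {l : Fin t → V}
    (h : Realizes c W E l) : Function.Injective l := by
  obtain ⟨T, G, f, hT, hf, hW, hE, hc, hl⟩ := h
  intro j k hjk
  rw [← hl, ← hl] at hjk
  exact G.lab.injective (hf hjk)

theorem Realizes.finRotate {W : Set V} {E : SimpleGraph V} {l : Fin t → V}
    (h : Realizes c W E l) : Realizes c W E (l ∘ finRotate t) := by
  obtain ⟨T, G, f, hT, hf, hW, hE, hc, hl⟩ := h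
  exact ⟨.one .gamma T, G.relabel (_root_.finRotate t), f, by simp [eval, hT], hf, hW, hE, hc,
    fun j => hl _⟩

theorem Realizes.swap {W : Set V} {E : SimpleGraph V} {l : Fin t → V}
    (h : Realizes c W E l) (ht : 2 ≤ t) :
    Realizes c W E (l ∘ Equiv.swap ⟨0, by omega⟩ ⟨1, by omega⟩) := by
  obtain ⟨T, G, f, hT, hf, hW, hE, hc, hl⟩ := h
  exact ⟨.one .i T, G.relabel (Equiv.swap ⟨0, by omega⟩ ⟨1, by omega⟩), f,
    by simp [eval, hT, ht], hf, hW, hE, hc, fun j => hl _⟩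

theorem closure_finRotate_swap (n : ℕ) :
    Subgroup.closure {_root_.finRotate (n + 2), Equiv.swap 0 1} = (⊤ : Subgroup _) := by
  have := Equiv.Perm.closure_cycle_adjacent_swap (isCycle_finRotate (n := n))
    support_finRotate 0
  simpa using this

/-- The operators `gamma` and `i` are a full cycle and an adjacent transposition, which generate all
permutations of the labels. For `t ≤ 1` there is nothing to permute. -/
theorem Realizes.perm {W : Set V} {E : SimpleGraph V} {l : Fin t → V}
    (h : Realizes c W E l) (σ : Equiv.Perm (Fin t)) : Realizes c W E (l ∘ σ) := by
  match t, l, h, σ with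
  | 0, l, h, σ => convert h
  | 1, l, h, σ => rw [Subsingleton.elim σ 1]; exact h
  | n + 2, l, h, σ =>
    have hfin : ∀ (τ : Equiv.Perm (Fin (n + 2))),
        τ ∈ Submonoid.closure {_root_.finRotate (n + 2), Equiv.swap 0 1} →
        ∀ l : Fin (n + 2) → V, Realizes c W E l → Realizes c W E (l ∘ τ) := by
      intro τ hτ
      induction hτ using Submonoid.closure_induction with
      | mem x hx =>
        rintro l hl
        rcases hx with rfl | rfl
        · exact hl.finRotate
        · exact hl.swap (by omega)
      | one => intro l hl; exact hl
      | mul x y _ _ hx hy => intro l hl; exact hy _ (hx _ hl)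
    refine hfin σ ?_ l h
    -- The operators come without inverses, but in a finite group the submonoid generated by a set
    -- is already the subgroup.
    rw [← Subgroup.closure_toSubmonoid_of_finite, closure_finRotate_swap]
    trivial

/-- From here on only the boundary set matters, not the order of the labels on it. -/
theorem Realizes.of_range_eq {W : Set V} {E : SimpleGraph V} {l l' : Fin t → V}
    (h : Realizes c W E l) (hl' : Function.Injective l') (hr : Set.range l' = Set.range l) :
    Realizes c W E l' := by
  let σ : Equiv.Perm (Fin t) := (Equiv.ofInjective l' hl').trans
    ((Equiv.setCongr hr).trans (Equiv.ofInjective l h.injective).symm)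
  have : l' = l ∘ σ := by
    funext j
    simp [σ, Equiv.apply_ofInjective_symm]
  rw [this]
  exact h.perm σ

/-- The operator `empty` gives color 1 to an initial segment of the labels, so an arbitrary coloring
of a bag must first be sorted. -/
theorem exists_perm_threshold (p : Fin t → Prop) :
    ∃ (k : Fin (t + 1)) (σ : Equiv.Perm (Fin t)), ∀ j, p (σ j) ↔ j.val < k.val := by
  classical
  let k : Fin (t + 1) := ⟨Fintype.card {j // p j}, by
    have := Fintype.card_subtype_le p
    simp at this ⊢
    omega⟩
  have hk : Fintype.card {j : Fin t // j.val < k.val} = Fintype.card {j // p j} := by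
    have : k.val ≤ t := by omega
    rw [Fintype.card_subtype]
    trans k.val
    · rw [Fin.card_filter_val_lt]; omega
    · rfl
  let e := Fintype.equivOfCardEq hk
  refine ⟨k, e.extendSubtype, fun j => ⟨fun h => ?_, fun h => e.extendSubtype_mem j h⟩⟩
  by_contra hj
  exact e.extendSubtype_not_mem j hj h

theorem realizes_bot (c : V → Color) {l : Fin t → V} (hl : Function.Injective l) :
    Realizes c (Set.range l) ⊥ l := by
  obtain ⟨k, σ, hσ⟩ := exists_perm_threshold fun j => c (l j) = Color.vert
  have h : Realizes c (Set.range (l ∘ σ)) ⊥ (l ∘ σ) := by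
    refine ⟨.leaf (.empty k), BGraph.empty t k, l ∘ σ, rfl, hl.comp σ.injective, rfl, ?_, ?_,
      fun j => rfl⟩
    · simp [BGraph.empty]
    · intro a
      have := hσ a
      simp only [BGraph.empty]
      split_ifs with h
      · exact this.2 h
      · cases hc : c ((l ∘ σ) a)
        · exact absurd (this.1 hc) h
        · rfl
  have hr : Set.range (l ∘ σ) = Set.range l := σ.surjective.range_comp l
  rw [hr] at h
  exact h.of_range_eq hl hr.symm

theorem Realizes.sup_edge {W : Set V} {E : SimpleGraph V} {l : Fin t → V}
    (h : Realizes c W E l) {x y : V} (hx : x ∈ Set.range l) (hy : y ∈ Set.range l) :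
    Realizes c W (E ⊔ SimpleGraph.edge x y) l := by
  obtain ⟨i, rfl⟩ := hx
  obtain ⟨j, rfl⟩ := hy
  by_cases hij : i = j
  · subst hij; simpa using h
  have ht : 2 ≤ t := by
    have := i.2; have := j.2; have : i.val ≠ j.val := fun h => hij (Fin.ext h)
    omega
  obtain ⟨σ, hσ0, hσ1⟩ : ∃ σ : Equiv.Perm (Fin t), σ ⟨0, by omega⟩ = i ∧ σ ⟨1, by omega⟩ = j := by
    let τ : Equiv.Perm (Fin t) := Equiv.swap ⟨0, by omega⟩ i
    -- `τ` sends 0 to `i`. The swap applied before it corrects the image of 1 and fixes 0, since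
    -- `τ.symm j` is not 0 when `i ≠ j`.
    refine ⟨(Equiv.swap ⟨1, by omega⟩ (τ.symm j)).trans τ, ?_, ?_⟩
    · have h01 : (⟨0, by omega⟩ : Fin t) ≠ ⟨1, by omega⟩ := by simp
      have h0j : (⟨0, by omega⟩ : Fin t) ≠ τ.symm j := by
        intro h
        apply hij
        rw [← τ.apply_symm_apply j, ← h]
        simp [τ]
      rw [Equiv.trans_apply, Equiv.swap_apply_of_ne_of_ne h01 h0j]
      simp [τ]
    · simp
  have hl := h.injective
  obtain ⟨T, G, f, hT, hf, hW, hE, hc, hfl⟩ := h.perm σ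
  have h' : Realizes c W (E ⊔ SimpleGraph.edge (l i) (l j)) (l ∘ σ) := by
    refine ⟨.one .e T, G.addEdge ht, f, by simp [eval, hT, ht], hf, hW, ?_, hc, hfl⟩
    have h0 := hfl ⟨0, by omega⟩
    have h1 := hfl ⟨1, by omega⟩
    simp only [Function.comp, hσ0, hσ1] at h0 h1
    intro x y
    simp only [BGraph.addEdge, SimpleGraph.sup_adj, hE, SimpleGraph.edge_adj, ← h0, ← h1]
    constructor
    · rintro (⟨a, b, hab, rfl, rfl⟩ | ⟨⟨rfl, rfl⟩ | ⟨rfl, rfl⟩, hne⟩)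
      · exact ⟨a, b, .inl hab, rfl, rfl⟩
      · exact ⟨_, _, .inr ⟨.inl ⟨rfl, rfl⟩, fun h => hne (congrArg f h)⟩, rfl, rfl⟩
      · exact ⟨_, _, .inr ⟨.inr ⟨rfl, rfl⟩, fun h => hne (congrArg f h)⟩, rfl, rfl⟩
    · rintro ⟨a, b, hab | ⟨⟨rfl, rfl⟩ | ⟨rfl, rfl⟩, hne⟩, rfl, rfl⟩
      · exact .inl ⟨a, b, hab, rfl, rfl⟩
      · exact .inr ⟨.inl ⟨rfl, rfl⟩, fun h => hne (hf h)⟩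
      · exact .inr ⟨.inr ⟨rfl, rfl⟩, fun h => hne (hf h)⟩
  exact h'.of_range_eq hl (σ.surjective.range_comp l).symm

theorem Realizes.sup_fromEdgeSet {W : Set V} {E : SimpleGraph V} {l : Fin t → V}
    (h : Realizes c W E l) {s : Set (Sym2 V)} (hs : s.Finite)
    (hsl : ∀ x y, s(x, y) ∈ s → x ∈ Set.range l ∧ y ∈ Set.range l) :
    Realizes c W (E ⊔ SimpleGraph.fromEdgeSet s) l := by
  induction s, hs using Set.Finite.induction_on with
  | empty => simpa using h
  | @insert a s ha hs ih =>
    have := ih fun x y hxy => hsl x y (Set.mem_insert_of_mem _ hxy)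
    induction a using Sym2.ind with
    | _ x y =>
      have hxy := hsl x y (Set.mem_insert _ _)
      have := this.sup_edge hxy.1 hxy.2
      convert this using 1
      rw [Set.insert_eq, SimpleGraph.fromEdgeSet_union, sup_assoc]
      congr 1
      rw [sup_comm]
      rfl

theorem realizes_of_adj_mem_range (c : V → Color) {l : Fin t → V} (hl : Function.Injective l)
    (E : SimpleGraph V) (hE : ∀ x y, E.Adj x y → x ∈ Set.range l ∧ y ∈ Set.range l) :
    Realizes c (Set.range l) E l := by
  have hfin : E.edgeSet.Finite := by
    refine (Set.finite_range fun p : Fin t × Fin t => s(l p.1, l p.2)).subset ?_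
    intro e he
    induction e using Sym2.ind with
    | _ x y =>
      obtain ⟨⟨i, rfl⟩, ⟨j, rfl⟩⟩ := hE x y he
      exact ⟨(i, j), rfl⟩
  simpa using (realizes_bot c hl).sup_fromEdgeSet hfin fun x y h => hE x y h

/-- Moving the first label to `u` and then applying a `u` operator makes `u` an interior vertex: it
leaves the boundary but stays in the graph. -/
theorem Realizes.newVertex {W : Set V} {E : SimpleGraph V} {l : Fin t → V}
    (h : Realizes c W E l) {u v : V} (hu : u ∈ Set.range l) (hv : v ∉ W) :
    ∃ l' : Fin t → V, Set.range l' = insert v (Set.range l \ {u}) ∧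
      Realizes c (insert v W) E l' := by
  obtain ⟨i, rfl⟩ := hu
  have ht : 1 ≤ t := by have := i.2; omega
  let z : Fin t := ⟨0, by omega⟩
  have hp := h.perm (Equiv.swap z i)
  set m : Fin t → V := l ∘ Equiv.swap z i with hm
  have hmz : m z = l i := by simp [hm]
  have hmr : Set.range m = Set.range l := (Equiv.swap z i).surjective.range_comp l
  have hmi := hp.injective
  obtain ⟨T, G, f, hT, hf, hW, hE, hc, hfl⟩ := hp
  have hvf : ∀ a, f a ≠ v := fun a ha => hv (hW ▸ ⟨a, ha⟩)
  refine ⟨fun j => if j = z then v else m j, ?_, .one (.u (c v)) T, G.newVertex ht (c v),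
    fun o => o.elim v f, by simp [eval, hT, ht], ?_, ?_, ?_, ?_, ?_⟩
  · rw [← hmr, ← hmz]
    ext x
    simp only [Set.mem_range, Set.mem_insert_iff, Set.mem_sdiff, Set.mem_singleton_iff]
    constructor
    · rintro ⟨j, rfl⟩
      split_ifs with hj
      · exact .inl rfl
      · exact .inr ⟨⟨j, rfl⟩, fun h => hj (hmi h)⟩
    · rintro (rfl | ⟨⟨j, rfl⟩, hj⟩)
      · exact ⟨z, if_pos rfl⟩
      · exact ⟨j, if_neg fun h => hj (congrArg m h)⟩
  · rintro (_ | a) (_ | b) hab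
    · rfl
    · exact absurd hab.symm (hvf b)
    · exact absurd hab (hvf a)
    · exact congrArg some (hf hab)
  · rw [← hW]
    ext x
    constructor
    · rintro ⟨_ | a, rfl⟩
      · exact .inl rfl
      · exact .inr ⟨a, rfl⟩
    · rintro (rfl | ⟨a, rfl⟩)
      · exact ⟨none, rfl⟩
      · exact ⟨some a, rfl⟩
  · intro x y
    rw [hE]
    constructor
    · rintro ⟨a, b, hab, rfl, rfl⟩
      exact ⟨some a, some b, (SimpleGraph.map_adj _ _ _ _).2 ⟨a, b, hab, rfl, rfl⟩, rfl, rfl⟩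
    · rintro ⟨_, _, hab, rfl, rfl⟩
      obtain ⟨a, b, hab', rfl, rfl⟩ := (SimpleGraph.map_adj _ _ _ _).1 hab
      exact ⟨a, b, hab', rfl, rfl⟩
  · rintro (_ | a)
    · rfl
    · exact hc a
  · intro j
    by_cases hj : j = z
    · change Option.elim (if j = z then none else some (G.lab j)) v f = if j = z then v else m j
      simp [hj]
    · change Option.elim (if j = z then none else some (G.lab j)) v f = if j = z then v else m j
      simpa [hj] using hfl j

theorem glue_adj {G₁ G₂ : BGraph t} (h : G₁.ColorCompatible G₂)
    (x y : (G₁.glue G₂ h).V) : (G₁.glue G₂ h).graph.Adj x y ↔ x ≠ y ∧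
      ((∃ a b, G₁.graph.Adj a b ∧ Glued.inl a = x ∧ Glued.inl b = y) ∨
       (∃ a b, G₂.graph.Adj a b ∧ Glued.inr a = x ∧ Glued.inr b = y)) := by
  change (_ ∧ _) ∨ (_ ∧ _) ↔ _
  exact and_or_left.symm

/-- Gluing identifies boundary vertices only. Since all common vertices of the two parts lie on the
boundary, the induced map from the glued graph to `V` is injective. -/
theorem Realizes.glue {W₁ W₂ : Set V} {E₁ E₂ : SimpleGraph V} {l : Fin t → V}
    (h₁ : Realizes c W₁ E₁ l) (h₂ : Realizes c W₂ E₂ l) (hW : W₁ ∩ W₂ ⊆ Set.range l) :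
    Realizes c (W₁ ∪ W₂) (E₁ ⊔ E₂) l := by
  obtain ⟨T₁, G₁, f₁, hT₁, hf₁, hW₁, hE₁, hc₁, hl₁⟩ := h₁
  obtain ⟨T₂, G₂, f₂, hT₂, hf₂, hW₂, hE₂, hc₂, hl₂⟩ := h₂
  have hcomp : G₁.ColorCompatible G₂ := fun j => by rw [← hc₁, ← hc₂, hl₁, hl₂]
  have hinter : ∀ a b, f₁ a = f₂ b → (Glued.inl a : Glued (G₁.SameLabel G₂)) = Glued.inr b := by
    intro a b hab
    have ha₁ : f₁ a ∈ W₁ := hW₁ ▸ Set.mem_range_self a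
    have ha₂ : f₁ a ∈ W₂ := hab ▸ hW₂ ▸ Set.mem_range_self b
    obtain ⟨j, hj⟩ := hW ⟨ha₁, ha₂⟩
    refine Quot.sound ⟨a, b, ⟨j, hf₁ ?_, hf₂ ?_⟩, rfl, rfl⟩
    · rw [hl₁, hj]
    · rw [hl₂, hj, hab]
  let f : Glued (G₁.SameLabel G₂) → V := Quot.lift (Sum.elim f₁ f₂) (by
    rintro _ _ ⟨_, _, ⟨j, rfl, rfl⟩, rfl, rfl⟩
    exact (hl₁ j).trans (hl₂ j).symm)
  have hfinj : Function.Injective f := by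
    rintro ⟨a | a⟩ ⟨b | b⟩ hab
    · exact congrArg Glued.inl (hf₁ hab)
    · exact hinter _ _ hab
    · exact (hinter _ _ hab.symm).symm
    · exact congrArg Glued.inr (hf₂ hab)
  refine ⟨.two .glue T₁ T₂, G₁.glue G₂ hcomp, f, by simp [eval, hT₁, hT₂, hcomp], hfinj,
    ?_, ?_, ?_, hl₁⟩
  · rw [← hW₁, ← hW₂]
    ext x
    constructor
    · rintro ⟨⟨a | a⟩, rfl⟩
      · exact .inl ⟨a, rfl⟩
      · exact .inr ⟨a, rfl⟩
    · rintro (⟨a, rfl⟩ | ⟨a, rfl⟩)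
      · exact ⟨Glued.inl a, rfl⟩
      · exact ⟨Glued.inr a, rfl⟩
  · intro x y
    rw [SimpleGraph.sup_adj, hE₁, hE₂]
    constructor
    · rintro (⟨a, b, hab, rfl, rfl⟩ | ⟨a, b, hab, rfl, rfl⟩)
      · exact ⟨Glued.inl a, Glued.inl b, (glue_adj _ _ _).2
          ⟨fun h => hab.ne (hf₁ (congrArg f h)), .inl ⟨a, b, hab, rfl, rfl⟩⟩, rfl, rfl⟩
      · exact ⟨Glued.inr a, Glued.inr b, (glue_adj _ _ _).2
          ⟨fun h => hab.ne (hf₂ (congrArg f h)), .inr ⟨a, b, hab, rfl, rfl⟩⟩, rfl, rfl⟩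
    · rintro ⟨_, _, hab, rfl, rfl⟩
      obtain ⟨-, ⟨a, b, hab', rfl, rfl⟩ | ⟨a, b, hab', rfl, rfl⟩⟩ := (glue_adj _ _ _).1 hab
      · exact .inl ⟨a, b, hab', rfl, rfl⟩
      · exact .inr ⟨a, b, hab', rfl, rfl⟩
  · rintro ⟨a | a⟩
    · exact hc₁ a
    · exact hc₂ a

theorem Realizes.mem_USmall {G : BGraph t}
    (h : Realizes G.color Set.univ G.graph G.lab) : G ∈ USmall t := by
  obtain ⟨T, G', f, hT, hf, hW, hE, hc, hl⟩ := h
  let e : G'.V ≃ G.V := Equiv.ofBijective f ⟨hf, Set.range_eq_univ.1 hW⟩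
  refine ⟨T, G', hT, ⟨e, ?_⟩, hc, hl⟩
  intro a b
  change G.graph.Adj (f a) (f b) ↔ _
  rw [hE]
  constructor
  · rintro ⟨a', b', hab, ha, hb⟩
    rwa [← hf ha, ← hf hb]
  · exact fun h => ⟨a, b, h, rfl, rfl⟩

end Realization

/-! ### Trees of bags of equal size, and expressions built from them -/

section BagTree

/-- Bags of a tree decomposition with root bag `S` and total vertex set `W`: every further bag
arises from an earlier one by exchanging one of its vertices for a new vertex. -/
inductive BagTree {V : Type} (S : Set V) : Set V → Set (Set V) → Prop
  | root : BagTree S S {S}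
  | step {W : Set V} {𝓑 : Set (Set V)} {p : Set V} {u v : V} : BagTree S W 𝓑 → p ∈ 𝓑 → u ∈ p →
      v ∉ W → BagTree S (insert v W) (insert (insert v (p \ {u})) 𝓑)

namespace BagTree

variable {V : Type} {S W : Set V} {𝓑 : Set (Set V)}

theorem root_mem (h : BagTree S W 𝓑) : S ∈ 𝓑 := by
  induction h with
  | root => rfl
  | step _ _ _ _ ih => exact .inr ih

theorem subset_of_mem (h : BagTree S W 𝓑) {B : Set V} (hB : B ∈ 𝓑) : B ⊆ W := by
  induction h generalizing B with
  | root => cases hB; rfl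
  | step _ hp hu hv ih =>
    rcases hB with rfl | hB
    · exact Set.insert_subset_insert (Set.sdiff_subset.trans (ih hp))
    · exact (ih hB).trans (Set.subset_insert _ _)

theorem ncard_eq [Finite V] (h : BagTree S W 𝓑) {B : Set V} (hB : B ∈ 𝓑) :
    B.ncard = S.ncard := by
  induction h generalizing B with
  | root => cases hB; rfl
  | step h hp hu hv ih =>
    rcases hB with rfl | hB
    · rw [Set.ncard_exchange (fun hvp => hv (h.subset_of_mem hp hvp)) hu]
      exact ih hp
    · exact ih hB

theorem image {V' : Type} {f : V → V'} (hf : Function.Injective f) (h : BagTree S W 𝓑) :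
    BagTree (f '' S) (f '' W) ((f '' ·) '' 𝓑) := by
  induction h with
  | root => simpa using BagTree.root
  | step h hp hu hv ih =>
    have := ih.step (Set.mem_image_of_mem _ hp) (Set.mem_image_of_mem f hu)
      (fun hv' => hv (hf.mem_set_image.1 hv'))
    simpa only [Set.image_insert_eq, Set.image_sdiff hf, Set.image_singleton] using this

/-- The exchange steps of the second tree are replayed on top of the first. A vertex new to the
second tree lies outside `S`, so by `hS` it is also new to the first. -/
theorem union {W' : Set V} {𝓑' : Set (Set V)} (h : BagTree S W 𝓑) (h' : BagTree S W' 𝓑')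
    (hS : W ∩ W' ⊆ S) : BagTree S (W ∪ W') (𝓑 ∪ 𝓑') := by
  induction h' with
  | root =>
    rwa [Set.union_eq_self_of_subset_right (h.subset_of_mem h.root_mem),
      Set.union_eq_self_of_subset_right (Set.singleton_subset_iff.2 h.root_mem)]
  | @step W' 𝓑' p u v h' hp hu hv ih =>
    have hvW : v ∉ W ∪ W' := by
      rintro (hvW | hvW)
      · exact hv (h'.subset_of_mem h'.root_mem (hS ⟨hvW, .inl rfl⟩))
      · exact hv hvW
    have := (ih ((Set.inter_subset_inter_right _ (Set.subset_insert _ _)).trans hS)).step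
      (.inr hp) hu hvW
    rwa [Set.union_insert, Set.union_insert]

/-- A `u` operator changes the boundary, hence the root, whereas `BagTree` grows away from its root.
Starting from the new root, one exchange returns to `S`, and the old steps follow. -/
theorem reroot (h : BagTree S W 𝓑) {u v : V} (hu : u ∈ S) (hv : v ∉ W) :
    BagTree (insert v (S \ {u})) (insert v W) (insert (insert v (S \ {u})) 𝓑) := by
  induction h with
  | root =>
    have huv : u ≠ v := fun h => hv (h ▸ hu)
    have hvS : v ∉ S \ {u} := fun h => hv h.1
    -- The reverse exchange: `v` is dropped and `u` comes in as the new vertex.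
    have := (BagTree.root (S := insert v (S \ {u}))).step rfl (Set.mem_insert v _)
      (v := u) (by simp [huv])
    rwa [Set.insert_sdiff_self_of_notMem hvS, Set.insert_sdiff_singleton,
      Set.insert_eq_of_mem hu, Set.insert_comm, Set.insert_sdiff_singleton,
      Set.insert_eq_of_mem hu, Set.pair_comm] at this
  | @step W 𝓑 p a b h hp ha hb ih =>
    have hbv : b ≠ v := fun h => hv (.inl h.symm)
    have := (ih fun h => hv (.inr h)).step (.inr hp) ha (v := b) (by simp [hbv, hb])
    rwa [Set.insert_comm, Set.insert_comm (insert b (p \ {a}))] at this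

/-- The new vertices of `A` are brought in one at a time along a path of bags starting at `p`. The
size bound leaves room: each time some vertex of the current bag lies outside `A` and can be given
up. -/
theorem exists_insert [Finite V] (h : BagTree S W 𝓑) {A p : Set V} (hp : p ∈ 𝓑)
    (hA : A.ncard ≤ S.ncard) (hAp : A ∩ W ⊆ p) :
    ∃ 𝓑', BagTree S (W ∪ A) 𝓑' ∧ 𝓑 ⊆ 𝓑' ∧ ∃ B ∈ 𝓑', A ⊆ B := by
  induction hn : (A \ W).ncard generalizing W 𝓑 p with
  | zero =>
    rw [Set.ncard_eq_zero, Set.sdiff_eq_empty] at hn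
    refine ⟨𝓑, by rwa [Set.union_eq_self_of_subset_right hn], subset_rfl, p, hp, ?_⟩
    exact fun x hx => hAp ⟨hx, hn hx⟩
  | succ n ih =>
    obtain ⟨v, hvA, hvW⟩ : (A \ W).Nonempty := by
      rw [← Set.ncard_pos]; omega
    have hvp : v ∉ p := fun hvp => hvW (h.subset_of_mem hp hvp)
    -- If `p ⊆ A`, the sizes force `p = A`, contradicting `v ∈ A` and `v ∉ p`.
    obtain ⟨u, hup, huA⟩ : ∃ u ∈ p, u ∉ A := by
      by_contra! hpA
      refine hvp (?_ : v ∈ p)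
      rwa [Set.eq_of_subset_of_ncard_le hpA (by rw [h.ncard_eq hp]; exact hA)]
    obtain ⟨𝓑', h', hsub, B, hB, hAB⟩ := ih (h.step hp hup hvW) (.inl rfl) (by
      rintro x ⟨hxA, rfl | hxW⟩
      · exact .inl rfl
      · exact .inr ⟨hAp ⟨hxA, hxW⟩, fun h => huA (h ▸ hxA)⟩) (by
      have : A \ insert v W = (A \ W) \ {v} := by
        ext x; simp only [Set.mem_sdiff, Set.mem_insert_iff, Set.mem_singleton_iff]; tauto
      have hv : v ∈ A \ W := ⟨hvA, hvW⟩
      rw [this, Set.ncard_sdiff_singleton_of_mem hv, hn]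
      rfl)
    refine ⟨𝓑', ?_, (Set.subset_insert _ _).trans hsub, B, hB, hAB⟩
    rwa [Set.insert_union, ← Set.union_insert, Set.insert_eq_of_mem hvA] at h'

end BagTree

/-- `Realizes` with a prescribed boundary set. -/
def BagRealizes {V : Type} (t : ℕ) (c : V → Color) (W : Set V) (E : SimpleGraph V)
    (B : Set V) : Prop :=
  ∃ l : Fin t → V, Set.range l = B ∧ Realizes c W E l

namespace BagRealizes

variable {V : Type} {t : ℕ} {c : V → Color}

theorem exchange {W : Set V} {E : SimpleGraph V} {B : Set V} (h : BagRealizes t c W E B)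
    {u v : V} (hu : u ∈ B) (hv : v ∉ W) :
    BagRealizes t c (insert v W) E (insert v (B \ {u})) := by
  obtain ⟨l, rfl, h⟩ := h
  exact h.newVertex hu hv

theorem glue {W₁ W₂ : Set V} {E₁ E₂ : SimpleGraph V} {B : Set V}
    (h₁ : BagRealizes t c W₁ E₁ B) (h₂ : BagRealizes t c W₂ E₂ B) (hB : W₁ ∩ W₂ ⊆ B) :
    BagRealizes t c (W₁ ∪ W₂) (E₁ ⊔ E₂) B := by
  obtain ⟨l₁, rfl, h₁⟩ := h₁
  obtain ⟨l₂, hl, h₂⟩ := h₂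
  exact ⟨l₁, rfl, h₁.glue (h₂.of_range_eq h₁.injective hl.symm) hB⟩

end BagRealizes

/-- `X B` and `E B` describe what has already been built with boundary `B`. The induction removes
the most recent bag, a leaf, and folds its part into that of its parent. The hypotheses say that
parts meet the bag tree only in their own bag and meet each other only inside the tree, so every
gluing happens along a boundary. -/
theorem BagTree.bagRealizes {V : Type} {t : ℕ} {c : V → Color} {S W : Set V} {𝓑 : Set (Set V)}
    (h : BagTree S W 𝓑) (X : Set V → Set V) (E : Set V → SimpleGraph V)
    (hX : ∀ B ∈ 𝓑, BagRealizes t c (X B) (E B) B) (hXW : ∀ B ∈ 𝓑, X B ∩ W = B)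
    (hXX : ∀ B ∈ 𝓑, ∀ B' ∈ 𝓑, B ≠ B' → X B ∩ X B' ⊆ W) :
    BagRealizes t c (⋃ B ∈ 𝓑, X B) (⨆ B ∈ 𝓑, E B) S := by
  classical
  induction h generalizing X E with
  | root => simpa using hX
  | @step W 𝓑 p u v h hp hu hv ih =>
    set B₀ := insert v (p \ {u}) with hB₀
    have hmem : B₀ ∈ insert B₀ 𝓑 := .inl rfl
    have hsub : ∀ B ∈ 𝓑, B ⊆ W := fun B => h.subset_of_mem
    have hvB : ∀ B ∈ 𝓑, v ∉ B := fun B hB hvB => hv (hsub B hB hvB)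
    have hvX : ∀ B ∈ 𝓑, v ∉ X B := fun B hB hvX =>
      hvB B hB (hXW B (.inr hB) ▸ ⟨hvX, .inl rfl⟩)
    have hne : ∀ B ∈ 𝓑, B ≠ B₀ := fun B hB h => hvB B hB (h ▸ .inl rfl)
    have huW : u ∈ W := hsub p hp hu
    have huv : u ≠ v := fun h => hv (h ▸ huW)
    have huB₀ : u ∉ B₀ := by simp [hB₀, huv]
    have huX : u ∉ X B₀ := fun h => huB₀ (hXW B₀ hmem ▸ ⟨h, .inr huW⟩)
    have hXB : ∀ B ∈ 𝓑, B ⊆ X B := fun B hB => by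
      conv_lhs => rw [← hXW B (.inr hB)]
      exact Set.inter_subset_left
    have hX₀ : ∀ x ∈ X B₀, x ∈ W → x ∈ p := fun x hx hxW => by
      have : x ∈ B₀ := hXW B₀ hmem ▸ ⟨hx, .inr hxW⟩
      rcases this with rfl | h
      · exact absurd hxW hv
      · exact h.1
    have hXX₀ : ∀ B ∈ 𝓑, ∀ x ∈ X B, x ∈ X B₀ → x ∈ W := fun B hB x hx hx₀ => by
      rcases hXX B (.inr hB) B₀ hmem (hne B hB) ⟨hx, hx₀⟩ with rfl | h
      · exact absurd hx (hvX B hB)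
      · exact h
    have hpW : ∀ x ∈ X p, x ∈ W → x ∈ p := fun x hx hxW =>
      hXW p (.inr hp) ▸ ⟨hx, .inr hxW⟩
    -- Exchanging `v` back for `u`, which does not occur in the part at the leaf, moves the boundary
    -- of that part from `B₀` to the parent bag `p`.
    have hmoved : BagRealizes t c (insert u (X B₀)) (E B₀) p := by
      have := (hX B₀ hmem).exchange (u := v) (.inl rfl) huX
      have hvp : v ∉ p \ {u} := fun h => hvB p hp h.1
      rwa [hB₀, Set.insert_sdiff_self_of_notMem hvp, Set.insert_sdiff_singleton,
        Set.insert_eq_of_mem hu] at this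
    have hglued := (hX p (.inr hp)).glue hmoved (by
      rintro x ⟨hx, rfl | hx₀⟩
      · exact hu
      · exact hpW x hx (hXX₀ p hp x hx hx₀))
    -- The smaller tree is used with the folded leaf glued to the part at `p`.
    have key := ih (Function.update X p (X p ∪ insert u (X B₀)))
      (Function.update E p (E p ⊔ E B₀)) ?_ ?_ ?_
    · convert key using 1
      · ext x
        simp only [Set.mem_iUnion, exists_prop, Set.mem_insert_iff]
        constructor
        · rintro ⟨B, rfl | hB, hx⟩
          · exact ⟨p, hp, by rw [Function.update_self]; exact .inr (.inr hx)⟩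
          · refine ⟨B, hB, ?_⟩
            by_cases hBp : B = p
            · subst hBp; rw [Function.update_self]; exact .inl hx
            · rwa [Function.update_of_ne hBp]
        · rintro ⟨B, hB, hx⟩
          by_cases hBp : B = p
          · subst hBp
            rw [Function.update_self] at hx
            rcases hx with hx | rfl | hx
            · exact ⟨B, .inr hB, hx⟩
            · exact ⟨B, .inr hB, hXB B hB hu⟩
            · exact ⟨B₀, .inl rfl, hx⟩
          · rw [Function.update_of_ne hBp] at hx
            exact ⟨B, .inr hB, hx⟩
      · ext x y
        simp only [SimpleGraph.iSup_adj, exists_prop, Set.mem_insert_iff]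
        constructor
        · rintro ⟨B, rfl | hB, hx⟩
          · exact ⟨p, hp, by rw [Function.update_self]; exact .inr hx⟩
          · refine ⟨B, hB, ?_⟩
            by_cases hBp : B = p
            · subst hBp; rw [Function.update_self]; exact .inl hx
            · rwa [Function.update_of_ne hBp]
        · rintro ⟨B, hB, hx⟩
          by_cases hBp : B = p
          · subst hBp
            rw [Function.update_self] at hx
            rcases hx with hx | hx
            · exact ⟨B, .inr hB, hx⟩
            · exact ⟨B₀, .inl rfl, hx⟩
          · rw [Function.update_of_ne hBp] at hx
            exact ⟨B, .inr hB, hx⟩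
    · intro B hB
      by_cases hBp : B = p
      · subst hBp; simpa only [Function.update_self] using hglued
      · simpa only [Function.update_of_ne hBp] using hX B (.inr hB)
    · intro B hB
      by_cases hBp : B = p
      · subst hBp
        rw [Function.update_self]
        ext x
        constructor
        · rintro ⟨hx | rfl | hx, hxW⟩
          · exact hpW x hx hxW
          · exact hu
          · exact hX₀ x hx hxW
        · exact fun hx => ⟨.inl (hXB B hB hx), hsub B hB hx⟩
      · rw [Function.update_of_ne hBp]
        ext x
        constructor
        · rintro ⟨hx, hxW⟩
          exact hXW B (.inr hB) ▸ ⟨hx, .inr hxW⟩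
        · exact fun hx => ⟨hXB B hB hx, hsub B hB hx⟩
    · have main : ∀ B ∈ 𝓑, ∀ B' ∈ 𝓑, B ≠ B' → ∀ x ∈ X B, x ∈ X B' → x ∈ W :=
        fun B hB B' hB' hBB x hx hx' => by
          rcases hXX B (.inr hB) B' (.inr hB') hBB ⟨hx, hx'⟩ with rfl | h
          · exact absurd hx (hvX B hB)
          · exact h
      rintro B hB B' hB' hBB x ⟨hx, hx'⟩
      by_cases hBp : B = p
      · subst hBp
        rw [Function.update_self] at hx
        rw [Function.update_of_ne hBB.symm] at hx'
        rcases hx with hx | rfl | hx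
        · exact main B hB B' hB' hBB x hx hx'
        · exact huW
        · exact hXX₀ B' hB' x hx' hx
      · rw [Function.update_of_ne hBp] at hx
        by_cases hBp' : B' = p
        · subst hBp'
          rw [Function.update_self] at hx'
          rcases hx' with hx' | rfl | hx'
          · exact main B hB B' hB' hBB x hx hx'
          · exact huW
          · exact hXX₀ B hB x hx hx'
        · rw [Function.update_of_ne hBp'] at hx'
          exact main B hB B' hB' hBB x hx hx'

/-- A rooted tree of bags of the size of the boundary that covers the graph. -/
def HasBagTree {t : ℕ} (G : BGraph t) : Prop :=
  ∃ 𝓑, BagTree (Set.range G.lab) Set.univ 𝓑 ∧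
    ∀ x y, G.graph.Adj x y → ∃ B ∈ 𝓑, x ∈ B ∧ y ∈ B

theorem HasBagTree.mem_USmall {t : ℕ} {G : BGraph t} (h : HasBagTree G) : G ∈ USmall t := by
  obtain ⟨𝓑, h, hE⟩ := h
  let E : Set G.V → SimpleGraph G.V := fun B =>
    { Adj := fun x y => G.graph.Adj x y ∧ x ∈ B ∧ y ∈ B
      symm := ⟨fun x y h => ⟨h.1.symm, h.2.2, h.2.1⟩⟩
      loopless := ⟨fun x h => h.1.ne rfl⟩ }
  have hU : ⋃ B ∈ 𝓑, B = Set.univ := by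
    suffices ∀ {S W : Set G.V} {𝓑}, BagTree S W 𝓑 → W ⊆ ⋃ B ∈ 𝓑, B from
      Set.univ_subset_iff.1 (this h)
    intro S W 𝓑 h
    induction h with
    | root => simp
    | step h hp hu hv ih =>
      rw [Set.biUnion_insert]
      exact Set.insert_subset (.inl (.inl rfl)) (ih.trans Set.subset_union_right)
  have hG : ⨆ B ∈ 𝓑, E B = G.graph := by
    ext x y
    simp only [SimpleGraph.iSup_adj, exists_prop]
    constructor
    · rintro ⟨B, -, h, -⟩
      exact h
    · intro h
      obtain ⟨B, hB, hx, hy⟩ := hE x y h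
      exact ⟨B, hB, h, hx, hy⟩
  -- Initially the part at each bag is just the bag with the edges inside it.
  have := h.bagRealizes (t := t) (c := G.color) id E ?_ (by simp) (by simp)
  · simp only [id, hU, hG] at this
    obtain ⟨l, hl, this⟩ := this
    exact (this.of_range_eq G.lab.injective hl.symm).mem_USmall
  · intro B hB
    have hcard : Nat.card (Fin t) = Nat.card B := by
      have := h.ncard_eq hB
      rw [Set.ncard_range_of_injective G.lab.injective] at this
      exact this.symm
    obtain ⟨e⟩ : Nonempty (Fin t ≃ B) := Finite.card_eq.1 hcard
    have hr : Set.range (fun j => (e j : G.V)) = B := by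
      rw [show (fun j => (e j : G.V)) = Subtype.val ∘ e from rfl, e.surjective.range_comp,
        Subtype.range_val]
    refine ⟨fun j => e j, hr, ?_⟩
    have := realizes_of_adj_mem_range G.color (Subtype.val_injective.comp e.injective) (E B)
      fun x y h => by
        change x ∈ Set.range (fun j => (e j : G.V)) ∧ y ∈ Set.range (fun j => (e j : G.V))
        rw [hr]; exact h.2
    change Realizes _ (Set.range fun j => (e j : G.V)) _ _ at this
    rwa [hr] at this

end BagTree

/-! ### Bag trees versus tree decompositions -/

section TreeDecomposition

/-- A tree with a new leaf `none` attached to the node `n`. -/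
def attachLeaf {N : Type} (T : SimpleGraph N) (n : N) : SimpleGraph (Option N) :=
  T.map Function.Embedding.some ⊔ SimpleGraph.edge none (some n)

theorem attachLeaf_adj_some {N : Type} {T : SimpleGraph N} {n x y : N} (h : T.Adj x y) :
    (attachLeaf T n).Adj (some x) (some y) :=
  .inl ((SimpleGraph.map_adj _ _ _ _).2 ⟨x, y, h, rfl, rfl⟩)

theorem attachLeaf_adj_none {N : Type} (T : SimpleGraph N) (n : N) :
    (attachLeaf T n).Adj (some n) none :=
  .inr (by simp [SimpleGraph.edge_adj])

theorem isTree_attachLeaf {N : Type} [Finite N] {T : SimpleGraph N} (hT : T.IsTree) (n : N) :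
    (attachLeaf T n).IsTree := by
  rw [SimpleGraph.isTree_iff_connected_and_card] at hT ⊢
  obtain ⟨hc, hcard⟩ := hT
  constructor
  · rw [SimpleGraph.connected_iff_exists_forall_reachable]
    refine ⟨some n, ?_⟩
    rintro (_ | x)
    · exact (attachLeaf_adj_none T n).reachable
    · exact (hc n x).map ⟨some, attachLeaf_adj_some⟩
  · have hedge : (attachLeaf T n).edgeSet =
        insert s(none, some n) (Function.Embedding.some.sym2Map '' T.edgeSet) := by
      rw [attachLeaf, SimpleGraph.edgeSet_sup, SimpleGraph.edgeSet_map,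
        SimpleGraph.edgeSet_edge_of_ne (by simp), Set.union_singleton]
    have hnot : s(none, some n) ∉ Function.Embedding.some.sym2Map '' T.edgeSet := by
      rintro ⟨e, -, he⟩
      induction e using Sym2.ind with
      | _ x y => simp at he
    rw [Nat.card_coe_set_eq] at hcard ⊢
    rw [hedge, Set.ncard_insert_of_notMem hnot,
      Set.ncard_image_of_injective _ Function.Embedding.some.sym2Map.injective, hcard,
      Finite.card_option]

theorem connected_induce_image_some {N : Type} {T : SimpleGraph N} (n : N) {A : Set N}
    (hA : (T.induce A).Connected) : ((attachLeaf T n).induce (some '' A)).Connected := by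
  refine hA.map (H := (attachLeaf T n).induce (some '' A))
    ⟨fun x => ⟨some x.1, Set.mem_image_of_mem some x.2⟩, fun h => attachLeaf_adj_some h⟩ ?_
  rintro ⟨_, x, hx, rfl⟩
  exact ⟨⟨x, hx⟩, rfl⟩

theorem connected_induce_insert {N : Type} {T : SimpleGraph N} {C : Set N}
    (hC : (T.induce C).Connected) {n m : N} (hn : n ∈ C) (h : T.Adj n m) :
    (T.induce (insert m C)).Connected := by
  have := SimpleGraph.induce_union_connected hC.preconnected
    (SimpleGraph.induce_pair_connected_of_adj h).preconnected ⟨n, hn, .inl rfl⟩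
  rwa [Set.union_insert, Set.union_singleton, Set.insert_eq_of_mem (Set.mem_insert_of_mem _ hn)]
    at this

/-- Each exchange becomes a new leaf below the bag it came from. The entering vertex occurs only at
the leaf, and every other vertex of the leaf bag occurs in the parent bag, so occurrence sets stay
connected. -/
theorem BagTree.exists_tree {V : Type} {S W : Set V} {𝓑 : Set (Set V)} (h : BagTree S W 𝓑) :
    ∃ (N : Type) (_ : Finite N) (T : SimpleGraph N) (bag : N → Set V), T.IsTree ∧
      Set.range bag = 𝓑 ∧ ∀ v ∈ W, (T.induce {x | v ∈ bag x}).Connected := by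
  induction h with
  | root =>
    refine ⟨Unit, inferInstance, ⊥, fun _ => S, .of_subsingleton, Set.range_const, ?_⟩
    intro v hv
    have : Nonempty {x : Unit | v ∈ S} := ⟨⟨(), hv⟩⟩
    exact SimpleGraph.IsTree.of_subsingleton.connected
  | @step W 𝓑 p u v h hp hu hv ih =>
    obtain ⟨N, _, T, bag, hT, rfl, hconn⟩ := ih
    obtain ⟨n, rfl⟩ := hp
    refine ⟨Option N, inferInstance, attachLeaf T n,
      fun o => o.elim (insert v (bag n \ {u})) bag, isTree_attachLeaf hT n, ?_, ?_⟩
    · ext B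
      constructor
      · rintro ⟨_ | x, rfl⟩
        · exact .inl rfl
        · exact .inr ⟨x, rfl⟩
      · rintro (rfl | ⟨x, rfl⟩)
        · exact ⟨none, rfl⟩
        · exact ⟨some x, rfl⟩
    · have hvbag : ∀ x, v ∉ bag x := fun x hx => hv (h.subset_of_mem ⟨x, rfl⟩ hx)
      rintro w (rfl | hw)
      · have heq : {x : Option N | w ∈ x.elim (insert w (bag n \ {u})) bag} = {none} := by
          ext (_ | x)
          · simp
          · simp [hvbag]
        rw [heq]
        exact SimpleGraph.IsTree.of_subsingleton.connected
      · have hwv : w ≠ v := fun h => hv (h ▸ hw)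
        have hsome := connected_induce_image_some n (hconn w hw)
        by_cases hwn : w ∈ bag n ∧ w ≠ u
        · have heq : {x : Option N | w ∈ x.elim (insert v (bag n \ {u})) bag} =
              insert none (some '' {x | w ∈ bag x}) := by
            ext (_ | x)
            · simp [hwn]
            · simp
          rw [heq]
          exact connected_induce_insert hsome ⟨n, hwn.1, rfl⟩ (attachLeaf_adj_none T n)
        · have heq : {x : Option N | w ∈ x.elim (insert v (bag n \ {u})) bag} =
              some '' {x | w ∈ bag x} := by
            ext (_ | x)
            · simpa [hwv] using hwn
            · simp
          rwa [heq]

/-- There is a tree decomposition with bags of size at most `t` in which the boundary is a bag. -/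
def HasBoundaryTD {t : ℕ} (G : BGraph t) : Prop :=
  ∃ D : TreeDecomposition G.graph, (∀ x, (D.bag x).ncard ≤ t) ∧
    ∃ x, D.bag x = Set.range G.lab

theorem HasBagTree.hasBoundaryTD {t : ℕ} {G : BGraph t} (h : HasBagTree G) :
    HasBoundaryTD G := by
  obtain ⟨𝓑, h, hE⟩ := h
  obtain ⟨N, hN, T, bag, hT, rfl, hconn⟩ := h.exists_tree
  obtain ⟨r, hr⟩ := h.root_mem
  refine ⟨⟨N, hN, T, hT, r, bag, ?_, ?_, fun v => hconn v trivial⟩, ?_, r, hr⟩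
  · intro v
    obtain ⟨x, hx⟩ := (hconn v trivial).nonempty
    exact ⟨x, hx⟩
  · intro x y hxy
    obtain ⟨_, ⟨n, rfl⟩, hn⟩ := hE x y hxy
    exact ⟨n, hn⟩
  · intro x
    rw [h.ncard_eq ⟨x, rfl⟩, Set.ncard_range_of_injective G.lab.injective, Nat.card_fin]

theorem exists_path_of_connected_induce {N : Type} {T : SimpleGraph N} {C : Set N}
    (hC : (T.induce C).Connected) {x y : N} (hx : x ∈ C) (hy : y ∈ C) :
    ∃ p : T.Walk x y, p.IsPath ∧ ∀ z ∈ p.support, z ∈ C := by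
  obtain ⟨p, hp⟩ := (hC ⟨x, hx⟩ ⟨y, hy⟩).exists_isPath
  refine ⟨p.map (SimpleGraph.Embedding.induce C).toHom,
    hp.map (SimpleGraph.Embedding.induce (G := T) C).injective, ?_⟩
  intro z hz
  obtain ⟨w, -, rfl⟩ := List.mem_map.1
    ((congrArg (z ∈ ·) (SimpleGraph.Walk.support_map (SimpleGraph.Embedding.induce C).toHom p)).mp hz)
  exact w.2

/-- The path from `n'` to `m` through `C` ends with the edge from `n`. Paths in a tree are unique,
so it is also the path along the bags containing `v`. -/
theorem TreeDecomposition.mem_bag_of_adj {V : Type} {G : SimpleGraph V}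
    (D : TreeDecomposition G) {C : Set D.Node} (hC : (D.tree.induce C).Connected)
    {n n' m : D.Node} (hn : n ∈ C) (hn' : n' ∈ C) (hm : m ∉ C) (h : D.tree.Adj n m)
    {v : V} (hv : v ∈ D.bag n') (hvm : v ∈ D.bag m) : v ∈ D.bag n := by
  obtain ⟨p, hp, hpC⟩ := exists_path_of_connected_induce hC hn' hn
  obtain ⟨q, hq, hqv⟩ := exists_path_of_connected_induce (D.subtree v) hv hvm
  have hp' := hp.concat (fun hmp => hm (hpC m hmp)) h
  have heq : p.concat h = q := congrArg Subtype.val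
    ((D.isTree.isAcyclic.subsingleton_path n' m).elim ⟨_, hp'⟩ ⟨q, hq⟩)
  refine hqv n ?_
  rw [← heq, SimpleGraph.Walk.support_concat]
  simp

/-- A maximal connected set `C` of nodes that is already covered must be everything. Otherwise an
edge leaves `C` from `n` to `m`, the old vertices of the bag at `m` lie in the bag at `n`, and
`exists_insert` covers `m` too. Bags of the decomposition may be small, so they are only contained
in bags of the tree. -/
theorem TreeDecomposition.exists_bagTree {V : Type} [Finite V] {G : SimpleGraph V}
    (D : TreeDecomposition G) (r : D.Node) (hD : ∀ x, (D.bag x).ncard ≤ (D.bag r).ncard) :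
    ∃ 𝓑, BagTree (D.bag r) Set.univ 𝓑 ∧ ∀ x, ∃ B ∈ 𝓑, D.bag x ⊆ B := by
  have := D.finNode
  let 𝒞 : Set (Set D.Node) := {C | r ∈ C ∧ (D.tree.induce C).Connected ∧
    ∃ 𝓑, BagTree (D.bag r) (⋃ n ∈ C, D.bag n) 𝓑 ∧ ∀ n ∈ C, ∃ B ∈ 𝓑, D.bag n ⊆ B}
  have hr : {r} ∈ 𝒞 := by
    refine ⟨rfl, SimpleGraph.IsTree.of_subsingleton.connected, {D.bag r}, ?_, ?_⟩
    · simpa using BagTree.root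
    · rintro n rfl
      exact ⟨_, rfl, subset_rfl⟩
  obtain ⟨C, ⟨hrC, hC, 𝓑, h𝓑, hcov⟩, hmax⟩ := (Set.toFinite 𝒞).exists_maximal ⟨_, hr⟩
  by_cases hCu : C = Set.univ
  · subst hCu
    refine ⟨𝓑, ?_, fun x => hcov x trivial⟩
    convert h𝓑
    symm
    rw [Set.eq_univ_iff_forall]
    intro v
    obtain ⟨x, hx⟩ := D.vertex_mem v
    simpa using ⟨x, hx⟩
  · exfalso
    obtain ⟨y, hy⟩ := (Set.ne_univ_iff_exists_notMem C).1 hCu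
    obtain ⟨w⟩ := D.isTree.connected r y
    obtain ⟨⟨⟨n, m⟩, hnm⟩, -, hn, hm⟩ := w.exists_boundary_dart C hrC hy
    simp only at hn hm hnm
    obtain ⟨p, hp, hnp⟩ := hcov n hn
    obtain ⟨𝓑', h', hsub, B, hB, hmB⟩ := h𝓑.exists_insert hp (hD m) (by
      rintro v ⟨hvm, hv⟩
      simp only [Set.mem_iUnion, exists_prop] at hv
      obtain ⟨n', hn', hv⟩ := hv
      exact hnp (D.mem_bag_of_adj hC hn hn' hm hnm hv hvm))
    have hins : insert m C ∈ 𝒞 := by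
      refine ⟨.inr hrC, connected_induce_insert hC hn hnm, 𝓑', ?_, ?_⟩
      · rwa [Set.biUnion_insert, Set.union_comm]
      · rintro k (rfl | hk)
        · exact ⟨B, hB, hmB⟩
        · obtain ⟨B', hB', hkB⟩ := hcov k hk
          exact ⟨B', hsub hB', hkB⟩
    exact hm (hmax hins (Set.subset_insert _ _) (.inl rfl))

theorem HasBoundaryTD.hasBagTree {t : ℕ} {G : BGraph t} (h : HasBoundaryTD G) :
    HasBagTree G := by
  obtain ⟨D, hD, r, hr⟩ := h
  obtain ⟨𝓑, h𝓑, hcov⟩ := D.exists_bagTree r (by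
    rw [hr, Set.ncard_range_of_injective G.lab.injective, Nat.card_fin]
    exact hD)
  refine ⟨𝓑, hr ▸ h𝓑, fun x y hxy => ?_⟩
  obtain ⟨n, hx, hy⟩ := D.edge_mem x y hxy
  obtain ⟨B, hB, hnB⟩ := hcov n
  exact ⟨B, hB, hnB hx, hnB hy⟩

/-- Tree decompositions can be pulled back along injective homomorphisms that preserve labels. -/
theorem HasBoundaryTD.of_injective {t : ℕ} {G G' : BGraph t} (h : HasBoundaryTD G')
    (f : G.V → G'.V) (hf : Function.Injective f)
    (hadj : ∀ x y, G.graph.Adj x y → G'.graph.Adj (f x) (f y))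
    (hlab : ∀ j, f (G.lab j) = G'.lab j) : HasBoundaryTD G := by
  obtain ⟨D, hD, r, hr⟩ := h
  refine ⟨⟨D.Node, D.finNode, D.tree, D.isTree, D.root, fun x => f ⁻¹' D.bag x,
    fun v => D.vertex_mem (f v), fun u w h => D.edge_mem _ _ (hadj u w h),
    fun v => D.subtree (f v)⟩, ?_, r, ?_⟩
  · intro x
    refine le_trans ?_ (hD x)
    rw [← Set.ncard_image_of_injective _ hf]
    exact Set.ncard_le_ncard (Set.image_preimage_subset _ _)
  · change f ⁻¹' D.bag r = _
    rw [hr]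
    ext v
    constructor
    · rintro ⟨j, hj⟩
      exact ⟨j, hf ((hlab j).trans hj)⟩
    · rintro ⟨j, rfl⟩
      exact ⟨j, (hlab j).symm⟩

/-! ### Gluing and the other operators preserve the bag structure -/

theorem Glued.inr_injective {A B : Type} {R : A → B → Prop}
    (hR : ∀ a b b', R a b → R a b' → b = b') : Function.Injective (Glued.inr : B → Glued R) := by
  intro b b' h
  let f : A ⊕ B → Set B := Sum.elim (fun a => {b | R a b}) (fun b => {b})
  have hf : ∀ x y : A ⊕ B, (∃ a b, R a b ∧ x = Sum.inl a ∧ y = Sum.inr b) → f x = f y := by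
    rintro _ _ ⟨a, b, hab, rfl, rfl⟩
    ext c
    exact ⟨fun hc => hR a c b hc hab, fun hc => by cases hc; exact hab⟩
  have h2 : ({b} : Set B) = {b'} := congrArg (Quot.lift f hf) h
  exact Set.singleton_injective h2

theorem Glued.inl_eq_inr_iff {A B : Type} {R : A → B → Prop}
    (hR : ∀ a a' b, R a b → R a' b → a = a') {a : A} {b : B} :
    (Glued.inl a : Glued R) = Glued.inr b ↔ R a b := by
  refine ⟨fun h => ?_, fun h => Quot.sound ⟨a, b, h, rfl, rfl⟩⟩
  -- An invariant of the identification: the set of elements of `A` that become equal to the given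
  -- one.
  let f : A ⊕ B → Set A := Sum.elim (fun a => {a}) (fun b => {a | R a b})
  have hf : ∀ x y : A ⊕ B, (∃ a b, R a b ∧ x = Sum.inl a ∧ y = Sum.inr b) → f x = f y := by
    rintro _ _ ⟨a, b, hab, rfl, rfl⟩
    ext c
    exact ⟨fun hc => by cases hc; exact hab, fun hc => hR c a b hc hab⟩
  have h2 : ({a} : Set A) = {a | R a b} := congrArg (Quot.lift f hf) h
  exact (h2 ▸ rfl : a ∈ {a | R a b})

theorem SameLabel.right_unique {t : ℕ} (G₁ G₂ : BGraph t) (v : G₁.V) (w w' : G₂.V)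
    (h : G₁.SameLabel G₂ v w) (h' : G₁.SameLabel G₂ v w') : w = w' := by
  obtain ⟨j, rfl, rfl⟩ := h
  obtain ⟨k, hk, rfl⟩ := h'
  rw [G₁.lab.injective hk]

theorem glue_inr_lab {t : ℕ} {G₁ G₂ : BGraph t} (h : G₁.ColorCompatible G₂) (j : Fin t) :
    (Glued.inr (G₂.lab j) : Glued (G₁.SameLabel G₂)) = (G₁.glue G₂ h).lab j :=
  (Quot.sound ⟨_, _, ⟨j, rfl, rfl⟩, rfl, rfl⟩ : Glued.inl (G₁.lab j) = Glued.inr (G₂.lab j)).symm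

theorem glue_inl_injective {t : ℕ} (G₁ G₂ : BGraph t) :
    Function.Injective (Glued.inl : G₁.V → Glued (G₁.SameLabel G₂)) :=
  Glued.inl_injective (BGraph.SameLabel.left_unique G₁ G₂)

theorem glue_inr_injective {t : ℕ} (G₁ G₂ : BGraph t) :
    Function.Injective (Glued.inr : G₂.V → Glued (G₁.SameLabel G₂)) :=
  Glued.inr_injective (SameLabel.right_unique G₁ G₂)

theorem HasBoundaryTD.of_glue_left {t : ℕ} {G₁ G₂ : BGraph t} {h : G₁.ColorCompatible G₂}
    (hG : HasBoundaryTD (G₁.glue G₂ h)) : HasBoundaryTD G₁ :=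
  hG.of_injective Glued.inl (glue_inl_injective G₁ G₂) (fun x y hxy => (glue_adj h _ _).2
    ⟨fun h => hxy.ne (glue_inl_injective G₁ G₂ h), .inl ⟨x, y, hxy, rfl, rfl⟩⟩) fun _ => rfl

theorem HasBoundaryTD.of_glue_right {t : ℕ} {G₁ G₂ : BGraph t} {h : G₁.ColorCompatible G₂}
    (hG : HasBoundaryTD (G₁.glue G₂ h)) : HasBoundaryTD G₂ :=
  hG.of_injective Glued.inr (glue_inr_injective G₁ G₂) (fun x y hxy => (glue_adj h _ _).2
    ⟨fun h => hxy.ne (glue_inr_injective G₁ G₂ h), .inr ⟨x, y, hxy, rfl, rfl⟩⟩) (glue_inr_lab h)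

theorem BagTree.hasBagTree {t : ℕ} {G : BGraph t} {S W : Set G.V} {𝓑 : Set (Set G.V)}
    (h : BagTree S W 𝓑) (hS : Set.range G.lab = S) (hW : W = Set.univ)
    (hE : ∀ x y, G.graph.Adj x y → ∃ B ∈ 𝓑, x ∈ B ∧ y ∈ B) : HasBagTree G := by
  subst hS hW
  exact ⟨𝓑, h, hE⟩

/-- The images of both trees have the common boundary as root, and the two sides overlap only there,
so `BagTree.union` applies. -/
theorem HasBagTree.glue {t : ℕ} {G₁ G₂ : BGraph t} (h₁ : HasBagTree G₁) (h₂ : HasBagTree G₂)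
    (h : G₁.ColorCompatible G₂) : HasBagTree (G₁.glue G₂ h) := by
  obtain ⟨𝓑₁, h₁, hE₁⟩ := h₁
  obtain ⟨𝓑₂, h₂, hE₂⟩ := h₂
  have h₁' := h₁.image (glue_inl_injective G₁ G₂)
  have h₂' := h₂.image (glue_inr_injective G₁ G₂)
  rw [← Set.range_comp] at h₁' h₂'
  have hl₁ : Glued.inl ∘ G₁.lab = (G₁.glue G₂ h).lab := rfl
  have hl₂ : Glued.inr ∘ G₂.lab = (G₁.glue G₂ h).lab := funext (glue_inr_lab h)
  rw [hl₁] at h₁'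
  rw [hl₂] at h₂'
  have := h₁'.union h₂' (by
    rintro _ ⟨⟨a, -, rfl⟩, ⟨b, -, hab⟩⟩
    obtain ⟨j, rfl, -⟩ := (Glued.inl_eq_inr_iff (BGraph.SameLabel.left_unique G₁ G₂)).1 hab.symm
    exact ⟨j, rfl⟩)
  refine this.hasBagTree rfl ?_ ?_
  · refine Set.eq_univ_iff_forall.2 ?_
    rintro ⟨a | a⟩
    · exact .inl ⟨a, trivial, rfl⟩
    · exact .inr ⟨a, trivial, rfl⟩
  · intro x y hxy
    obtain ⟨-, ⟨a, b, hab, rfl, rfl⟩ | ⟨a, b, hab, rfl, rfl⟩⟩ := (glue_adj h x y).1 hxy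
    · obtain ⟨B, hB, ha, hb⟩ := hE₁ a b hab
      exact ⟨_, .inl ⟨B, hB, rfl⟩, ⟨a, ha, rfl⟩, ⟨b, hb, rfl⟩⟩
    · obtain ⟨B, hB, ha, hb⟩ := hE₂ a b hab
      exact ⟨_, .inr ⟨B, hB, rfl⟩, ⟨a, ha, rfl⟩, ⟨b, hb, rfl⟩⟩

theorem HasBagTree.newVertex {t : ℕ} {G : BGraph t} (h : HasBagTree G) (ht : 1 ≤ t) (l : Color) :
    HasBagTree (G.newVertex ht l) := by
  obtain ⟨𝓑, h, hE⟩ := h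
  let z : Fin t := ⟨0, by omega⟩
  have := (h.image (Option.some_injective G.V)).reroot (u := some (G.lab z)) (v := none)
    ⟨_, ⟨z, rfl⟩, rfl⟩ (by simp)
  have hlab : ∀ j, (G.newVertex ht l).lab j = if j = z then none else some (G.lab j) :=
    fun j => rfl
  refine this.hasBagTree (G := G.newVertex ht l) ?_ ?_ ?_
  · ext x
    simp only [Set.mem_range, hlab]
    constructor
    · rintro ⟨j, rfl⟩
      split_ifs with hj
      · exact .inl rfl
      · refine .inr ⟨⟨_, ⟨j, rfl⟩, rfl⟩, fun h => hj ?_⟩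
        exact G.lab.injective (Option.some_injective _ h)
    · rintro (rfl | ⟨⟨_, ⟨j, rfl⟩, rfl⟩, hj⟩)
      · exact ⟨z, if_pos rfl⟩
      · exact ⟨j, if_neg fun h => hj (by subst h; rfl)⟩
  · refine Set.eq_univ_iff_forall.2 ?_
    rintro (_ | a)
    · exact .inl rfl
    · exact .inr ⟨a, trivial, rfl⟩
  · intro x y hxy
    obtain ⟨a, b, hab, rfl, rfl⟩ := (SimpleGraph.map_adj _ _ _ _).1 hxy
    obtain ⟨B, hB, ha, hb⟩ := hE a b hab
    exact ⟨_, .inr ⟨B, hB, rfl⟩, ⟨a, ha, rfl⟩, ⟨b, hb, rfl⟩⟩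

theorem HasBagTree.relabel {t : ℕ} {G : BGraph t} (h : HasBagTree G)
    (σ : Equiv.Perm (Fin t)) : HasBagTree (G.relabel σ) := by
  obtain ⟨𝓑, h, hE⟩ := h
  refine ⟨𝓑, ?_, hE⟩
  have : Set.range (G.relabel σ).lab = Set.range G.lab := σ.surjective.range_comp G.lab
  rwa [this]

theorem HasBagTree.addEdge {t : ℕ} {G : BGraph t} (h : HasBagTree G) (ht : 2 ≤ t) :
    HasBagTree (G.addEdge ht) := by
  obtain ⟨𝓑, h, hE⟩ := h
  refine ⟨𝓑, h, ?_⟩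
  rintro x y (hxy | hxy)
  · exact hE x y hxy
  · refine ⟨_, h.root_mem, ?_⟩
    rcases ((SimpleGraph.edge_adj _ _ _ _).1 hxy).1 with ⟨rfl, rfl⟩ | ⟨rfl, rfl⟩ <;>
      exact ⟨⟨_, rfl⟩, ⟨_, rfl⟩⟩

theorem hasBagTree_empty (t : ℕ) (k : Fin (t + 1)) : HasBagTree (BGraph.empty t k) := by
  refine ⟨{Set.univ}, ?_, fun x y h => h.elim⟩
  have : Set.range (BGraph.empty t k).lab = Set.univ := Set.range_id
  rw [this]
  exact .root

theorem hasBagTree_of_eval {t : ℕ} (T : BinTree (Op t)) :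
    ∀ {G : BGraph t}, eval T = some G → HasBagTree G := by
  induction T with
  | leaf a =>
    intro G hG
    cases a <;> simp only [eval, reduceCtorEq, Option.some.injEq] at hG
    subst hG
    exact hasBagTree_empty t _
  | one a x ih =>
    intro G hG
    cases a <;> simp only [eval, reduceCtorEq, Option.bind_eq_some_iff,
      Option.map_eq_some_iff] at hG
    case gamma =>
      obtain ⟨G', hG', rfl⟩ := hG
      exact (ih hG').relabel _
    all_goals
      obtain ⟨G', hG', hG⟩ := hG
      split_ifs at hG with ht
      cases hG
    · exact (ih hG').addEdge ht
    · exact (ih hG').newVertex ht _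
    · exact (ih hG').relabel _
  | two a x y ihx ihy =>
    intro G hG
    cases a <;> simp only [eval, reduceCtorEq, Option.bind_eq_some_iff] at hG
    obtain ⟨G₁, hG₁, G₂, hG₂, hG⟩ := hG
    split_ifs at hG with h
    cases hG
    exact (ihx hG₁).glue (ihy hG₂) h

/-- Every operator preserves bag trees, and bag trees unfold into decompositions. Conversely, a
decomposition normalizes to a bag tree, which is turned into an expression. -/
theorem mem_USmall_iff {t : ℕ} {G : BGraph t} : G ∈ USmall t ↔ HasBoundaryTD G := by
  refine ⟨?_, fun h => h.hasBagTree.mem_USmall⟩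
  rintro ⟨T, G', hT, f, -, hl⟩
  have h := (hasBagTree_of_eval T hT).hasBoundaryTD
  refine h.of_injective f.symm f.symm.injective (fun x y hxy => f.symm.map_rel_iff.2 hxy) ?_
  intro j
  rw [← hl, RelIso.symm_apply_apply]

end TreeDecomposition

/-! ### Invariance under renaming -/

section Isomorphism

variable {t : ℕ}

theorem BGraph.LabeledIso.symm {G₁ G₂ : BGraph t} (h : G₁.LabeledIso G₂) : G₂.LabeledIso G₁ := by
  obtain ⟨f, hc, hl⟩ := h
  refine ⟨f.symm, fun v => ?_, fun j => ?_⟩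
  · rw [← hc, RelIso.apply_symm_apply]
  · rw [← hl, RelIso.symm_apply_apply]

theorem BGraph.LabeledIso.trans {G₁ G₂ G₃ : BGraph t} (h : G₁.LabeledIso G₂)
    (h' : G₂.LabeledIso G₃) : G₁.LabeledIso G₃ := by
  obtain ⟨f, hc, hl⟩ := h
  obtain ⟨f', hc', hl'⟩ := h'
  refine ⟨f.trans f', fun v => ?_, fun j => ?_⟩
  · exact (hc' _).trans (hc v)
  · exact (congrArg f' (hl j)).trans (hl' j)

theorem BGraph.LabeledIso.glue {G₁ G₂ G₁' G₂' : BGraph t} (h₁ : G₁.LabeledIso G₁')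
    (h₂ : G₂.LabeledIso G₂') (h : G₁.ColorCompatible G₂) (h' : G₁'.ColorCompatible G₂') :
    (G₁.glue G₂ h).LabeledIso (G₁'.glue G₂' h') := by
  obtain ⟨f₁, hc₁, hl₁⟩ := h₁
  obtain ⟨f₂, hc₂, hl₂⟩ := h₂
  let e : (G₁.glue G₂ h).V ≃ (G₁'.glue G₂' h').V :=
    Quot.congr (f₁.toEquiv.sumCongr f₂.toEquiv) (by
      intro x y
      constructor
      · rintro ⟨_, _, ⟨j, rfl, rfl⟩, rfl, rfl⟩
        exact ⟨_, _, ⟨j, (hl₁ j).symm, (hl₂ j).symm⟩, rfl, rfl⟩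
      · rintro ⟨_, _, ⟨j, rfl, rfl⟩, hx, hy⟩
        refine ⟨_, _, ⟨j, rfl, rfl⟩, ?_, ?_⟩
        · apply (f₁.toEquiv.sumCongr f₂.toEquiv).injective
          rw [hx]
          exact congrArg Sum.inl (hl₁ j).symm
        · apply (f₁.toEquiv.sumCongr f₂.toEquiv).injective
          rw [hy]
          exact congrArg Sum.inr (hl₂ j).symm)
  refine ⟨⟨e, ?_⟩, ?_, ?_⟩
  · intro x y
    refine (glue_adj h' _ _).trans (Iff.trans ?_ (glue_adj h x y).symm)
    refine and_congr e.injective.ne_iff (or_congr ?_ ?_)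
    · constructor
      · rintro ⟨a, b, hab, ha, hb⟩
        refine ⟨f₁.symm a, f₁.symm b, f₁.symm.map_rel_iff.2 hab, e.injective ?_, e.injective ?_⟩
        · exact (congrArg Glued.inl (f₁.apply_symm_apply a)).trans ha
        · exact (congrArg Glued.inl (f₁.apply_symm_apply b)).trans hb
      · rintro ⟨a, b, hab, rfl, rfl⟩
        exact ⟨f₁ a, f₁ b, f₁.map_rel_iff.2 hab, rfl, rfl⟩
    · constructor
      · rintro ⟨a, b, hab, ha, hb⟩
        refine ⟨f₂.symm a, f₂.symm b, f₂.symm.map_rel_iff.2 hab, e.injective ?_, e.injective ?_⟩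
        · exact (congrArg Glued.inr (f₂.apply_symm_apply a)).trans ha
        · exact (congrArg Glued.inr (f₂.apply_symm_apply b)).trans hb
      · rintro ⟨a, b, hab, rfl, rfl⟩
        exact ⟨f₂ a, f₂ b, f₂.map_rel_iff.2 hab, rfl, rfl⟩
  · rintro ⟨a | a⟩
    · exact hc₁ a
    · exact hc₂ a
  · exact fun j => congrArg Glued.inl (hl₁ j)

theorem Generates.of_iso {T : BinTree (Op t)} {G G' : BGraph t} (h : Generates T G)
    (hG : G.LabeledIso G') : Generates T G' := by
  obtain ⟨G₀, hT, hG₀⟩ := h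
  exact ⟨G₀, hT, hG₀.trans hG⟩

theorem Generates.iso {T : BinTree (Op t)} {G G' : BGraph t} (h : Generates T G)
    (h' : Generates T G') : G.LabeledIso G' := by
  obtain ⟨G₀, hT, hG₀⟩ := h
  obtain ⟨G₁, hT', hG₁⟩ := h'
  cases hT.symm.trans hT'
  exact hG₀.symm.trans hG₁

theorem BGraph.LabeledIso.color_lab {G G' : BGraph t} (h : G.LabeledIso G') (j : Fin t) :
    G'.color (G'.lab j) = G.color (G.lab j) := by
  obtain ⟨f, hc, hl⟩ := h
  rw [← hl, hc]

theorem Generates.glue {T₁ T₂ : BinTree (Op t)} {G₁ G₂ : BGraph t} (h₁ : Generates T₁ G₁)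
    (h₂ : Generates T₂ G₂) (h : G₁.ColorCompatible G₂) :
    Generates (.two .glue T₁ T₂) (G₁.glue G₂ h) := by
  obtain ⟨G₁', hT₁, hG₁⟩ := h₁
  obtain ⟨G₂', hT₂, hG₂⟩ := h₂
  have h' : G₁'.ColorCompatible G₂' := fun j => by
    rw [← hG₁.color_lab, ← hG₂.color_lab]; exact h j
  exact ⟨G₁'.glue G₂' h', by simp [eval, hT₁, hT₂, h'], hG₁.glue hG₂ h' h⟩

theorem mem_USmall_of_iso {G G' : BGraph t} (hG : G ∈ USmall t) (h : G.LabeledIso G') :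
    G' ∈ USmall t := by
  obtain ⟨T, hT⟩ := hG
  exact ⟨T, hT.of_iso h⟩

theorem BHypergraph.LabeledIso.symm {H₁ H₂ : BHypergraph t} (h : H₁.LabeledIso H₂) :
    H₂.LabeledIso H₁ := by
  obtain ⟨f, g, hm, hl⟩ := h
  refine ⟨f.symm, g.symm, fun v e => ?_, fun j => ?_⟩
  · rw [← hm, f.apply_symm_apply, g.apply_symm_apply]
  · rw [← hl, Sum.map_map]
    simp

theorem BHypergraph.LabeledIso.trans {H₁ H₂ H₃ : BHypergraph t} (h : H₁.LabeledIso H₂)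
    (h' : H₂.LabeledIso H₃) : H₁.LabeledIso H₃ := by
  obtain ⟨f, g, hm, hl⟩ := h
  obtain ⟨f', g', hm', hl'⟩ := h'
  refine ⟨f.trans f', g.trans g', fun v e => (hm' _ _).trans (hm _ _), fun j => ?_⟩
  rw [← hl', ← hl, Sum.map_map]
  rfl

theorem toHypergraph_lab_vert {G : BGraph t} {j : Fin t} (h : G.color (G.lab j) = Color.vert) :
    G.toHypergraph.lab j = Sum.inl ⟨G.lab j, h⟩ := by
  change (match h : G.color (G.lab j) with
    | Color.vert => Sum.inl ⟨G.lab j, h⟩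
    | Color.edge => Sum.inr ⟨G.lab j, h⟩ : G.toHypergraph.V ⊕ G.toHypergraph.E) = _
  split
  · rfl
  · next h' => exact absurd (h.symm.trans h') (by simp)

theorem toHypergraph_lab_edge {G : BGraph t} {j : Fin t} (h : G.color (G.lab j) = Color.edge) :
    G.toHypergraph.lab j = Sum.inr ⟨G.lab j, h⟩ := by
  change (match h : G.color (G.lab j) with
    | Color.vert => Sum.inl ⟨G.lab j, h⟩
    | Color.edge => Sum.inr ⟨G.lab j, h⟩ : G.toHypergraph.V ⊕ G.toHypergraph.E) = _
  split
  · next h' => exact absurd (h.symm.trans h') (by simp)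
  · rfl

theorem BGraph.LabeledIso.toHypergraph {G G' : BGraph t} (h : G.LabeledIso G') :
    G.toHypergraph.LabeledIso G'.toHypergraph := by
  have hcol := h.color_lab
  obtain ⟨f, hc, hl⟩ := h
  refine ⟨f.toEquiv.subtypeEquiv fun v => ?_, f.toEquiv.subtypeEquiv fun v => ?_,
    fun v e => f.map_rel_iff, fun j => ?_⟩
  · exact (by rw [← hc v]; rfl)
  · exact (by rw [← hc v]; rfl)
  · cases h : G.color (G.lab j)
    · rw [toHypergraph_lab_vert h, toHypergraph_lab_vert ((hcol j).trans h)]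
      exact congrArg Sum.inl (Subtype.ext (hl j))
    · rw [toHypergraph_lab_edge h, toHypergraph_lab_edge ((hcol j).trans h)]
      exact congrArg Sum.inr (Subtype.ext (hl j))

end Isomorphism

/-! ### Incidence graphs, gluing, and the boundary-bag condition -/

section IncidenceGraph

variable {t : ℕ}

theorem adj_coloredIncidenceGraph {H : BHypergraph t} (v : H.V) (e : H.E) :
    H.coloredIncidenceGraph.graph.Adj (Sum.inr e) (Sum.inl v) ↔ H.mem v e := by
  change (_ ∨ _) ↔ _
  constructor
  · rintro (⟨_, _, h, ⟨⟩, ⟨⟩⟩ | ⟨_, _, h, ⟨⟩, ⟨⟩⟩)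
    exact h
  · exact fun h => .inr ⟨v, e, h, rfl, rfl⟩

theorem wellColored_coloredIncidenceGraph (H : BHypergraph t) :
    H.coloredIncidenceGraph.WellColored := by
  rintro v w (⟨_, _, h, rfl, rfl⟩ | ⟨_, _, h, rfl, rfl⟩) <;>
    simp [BHypergraph.coloredIncidenceGraph]

theorem labeledIso_toHypergraph_coloredIncidenceGraph (H : BHypergraph t) :
    H.LabeledIso H.coloredIncidenceGraph.toHypergraph := by
  let f : H.V → H.coloredIncidenceGraph.toHypergraph.V := fun v => ⟨Sum.inl v, rfl⟩
  let g : H.E → H.coloredIncidenceGraph.toHypergraph.E := fun e => ⟨Sum.inr e, rfl⟩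
  have hf : Function.Bijective f := by
    refine ⟨fun v v' h => Sum.inl_injective (congrArg Subtype.val h), ?_⟩
    rintro ⟨v | e, h⟩
    · exact ⟨v, rfl⟩
    · exact absurd h (by simp [BHypergraph.coloredIncidenceGraph])
  have hg : Function.Bijective g := by
    refine ⟨fun v v' h => Sum.inr_injective (congrArg Subtype.val h), ?_⟩
    rintro ⟨v | e, h⟩
    · exact absurd h (by simp [BHypergraph.coloredIncidenceGraph])
    · exact ⟨e, rfl⟩
  refine ⟨Equiv.ofBijective f hf, Equiv.ofBijective g hg,
    fun v e => adj_coloredIncidenceGraph v e, fun j => ?_⟩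
  rcases hj : H.lab j with v | e
  · have hc : H.coloredIncidenceGraph.color (H.coloredIncidenceGraph.lab j) = Color.vert := by
      change Sum.elim _ _ (H.lab j) = _
      rw [hj]; rfl
    rw [toHypergraph_lab_vert hc]
    exact congrArg Sum.inl (Subtype.ext hj.symm)
  · have hc : H.coloredIncidenceGraph.color (H.coloredIncidenceGraph.lab j) = Color.edge := by
      change Sum.elim _ _ (H.lab j) = _
      rw [hj]; rfl
    rw [toHypergraph_lab_edge hc]
    exact congrArg Sum.inr (Subtype.ext hj.symm)

theorem BHypergraph.Gluable.colorCompatible {H₁ H₂ : BHypergraph t} (h : H₁.Gluable H₂) :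
    H₁.coloredIncidenceGraph.ColorCompatible H₂.coloredIncidenceGraph := by
  intro j
  have := h j
  change Sum.elim _ _ (H₁.lab j) = Sum.elim _ _ (H₂.lab j)
  cases h₁ : H₁.lab j <;> cases h₂ : H₂.lab j <;> simp_all

/-- Identifying two color-2 vertices unites their neighborhoods, which is exactly the union of the
two hyperedges. Gluability ensures that the quotient of the disjoint union splits by color. -/
theorem glue_coloredIncidenceGraph_iso {H₁ H₂ : BHypergraph t} (h : H₁.Gluable H₂) :
    (H₁.coloredIncidenceGraph.glue H₂.coloredIncidenceGraph h.colorCompatible).LabeledIso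
      (H₁.glue H₂ h).coloredIncidenceGraph := by
  let e : Glued (H₁.coloredIncidenceGraph.SameLabel H₂.coloredIncidenceGraph) ≃
      Glued (H₁.SameLabelV H₂) ⊕ Glued (H₁.SameLabelE H₂) :=
    { toFun := Quot.lift
        (Sum.elim (Sum.map Glued.inl Glued.inl) (Sum.map Glued.inr Glued.inr)) (by
          rintro _ _ ⟨_, _, ⟨j, rfl, rfl⟩, rfl, rfl⟩
          have hj := h j
          change Sum.map Glued.inl Glued.inl (H₁.lab j) = Sum.map Glued.inr Glued.inr (H₂.lab j)
          rcases h₁ : H₁.lab j with v | v <;> rcases h₂ : H₂.lab j with w | w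
          · exact congrArg Sum.inl (Quot.sound ⟨v, w, ⟨j, h₁, h₂⟩, rfl, rfl⟩)
          · simp [h₁, h₂] at hj
          · simp [h₁, h₂] at hj
          · exact congrArg Sum.inr (Quot.sound ⟨v, w, ⟨j, h₁, h₂⟩, rfl, rfl⟩))
      invFun := Sum.elim
        (Quot.lift (Sum.elim (fun v => Glued.inl (Sum.inl v)) (fun v => Glued.inr (Sum.inl v))) (by
          rintro _ _ ⟨v, w, ⟨j, h₁, h₂⟩, rfl, rfl⟩
          exact Quot.sound ⟨_, _, ⟨j, h₁, h₂⟩, rfl, rfl⟩))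
        (Quot.lift (Sum.elim (fun v => Glued.inl (Sum.inr v)) (fun v => Glued.inr (Sum.inr v))) (by
          rintro _ _ ⟨v, w, ⟨j, h₁, h₂⟩, rfl, rfl⟩
          exact Quot.sound ⟨_, _, ⟨j, h₁, h₂⟩, rfl, rfl⟩))
      left_inv := by rintro ⟨(v | v) | (v | v)⟩ <;> rfl
      right_inv := by
        rintro (v | v) <;> induction v using Quot.ind with | _ v => rcases v with v | v <;> rfl }
  refine ⟨⟨e, ?_⟩, ?_, fun j => rfl⟩
  · intro x y
    refine Iff.trans ?_ (glue_adj h.colorCompatible x y).symm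
    constructor
    · intro hxy
      refine ⟨fun hne => hxy.ne (congrArg e hne), ?_⟩
      rcases hxy with ⟨_, _, ⟨v, w, hm, rfl, rfl⟩ | ⟨v, w, hm, rfl, rfl⟩, hx, hy⟩ |
        ⟨_, _, ⟨v, w, hm, rfl, rfl⟩ | ⟨v, w, hm, rfl, rfl⟩, hy, hx⟩
      · exact .inl ⟨.inl v, .inr w, .inl ⟨v, w, hm, rfl, rfl⟩, e.injective hx.symm,
          e.injective hy.symm⟩
      · exact .inr ⟨.inl v, .inr w, .inl ⟨v, w, hm, rfl, rfl⟩, e.injective hx.symm,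
          e.injective hy.symm⟩
      · exact .inl ⟨.inr w, .inl v, .inr ⟨v, w, hm, rfl, rfl⟩, e.injective hx.symm,
          e.injective hy.symm⟩
      · exact .inr ⟨.inr w, .inl v, .inr ⟨v, w, hm, rfl, rfl⟩, e.injective hx.symm,
          e.injective hy.symm⟩
    · rintro ⟨-, ⟨_, _, ⟨v, w, hm, rfl, rfl⟩ | ⟨v, w, hm, rfl, rfl⟩, rfl, rfl⟩ |
        ⟨_, _, ⟨v, w, hm, rfl, rfl⟩ | ⟨v, w, hm, rfl, rfl⟩, rfl, rfl⟩⟩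
      · exact .inl ⟨_, _, .inl ⟨v, w, hm, rfl, rfl⟩, rfl, rfl⟩
      · exact .inr ⟨_, _, .inl ⟨v, w, hm, rfl, rfl⟩, rfl, rfl⟩
      · exact .inl ⟨_, _, .inr ⟨v, w, hm, rfl, rfl⟩, rfl, rfl⟩
      · exact .inr ⟨_, _, .inr ⟨v, w, hm, rfl, rfl⟩, rfl, rfl⟩
  · rintro ⟨(v | v) | (v | v)⟩ <;> rfl

theorem mem_USmall_glue_iff {H₁ H₂ : BHypergraph t} (h : H₁.Gluable H₂) :
    (H₁.glue H₂ h).coloredIncidenceGraph ∈ USmall t ↔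
      H₁.coloredIncidenceGraph ∈ USmall t ∧ H₂.coloredIncidenceGraph ∈ USmall t := by
  have hiso := glue_coloredIncidenceGraph_iso h
  constructor
  · intro hG
    have := mem_USmall_iff.1 (mem_USmall_of_iso hG hiso.symm)
    exact ⟨mem_USmall_iff.2 this.of_glue_left, mem_USmall_iff.2 this.of_glue_right⟩
  · rintro ⟨⟨T₁, hT₁⟩, ⟨T₂, hT₂⟩⟩
    exact ⟨_, (hT₁.glue hT₂ h.colorCompatible).of_iso hiso⟩

theorem mem_boundaryBagPart_iff {P : Set (BHypergraph t)} {H : BHypergraph t} :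
    H ∈ boundaryBagPart P ↔ H ∈ P ∧ H.coloredIncidenceGraph ∈ USmall t := by
  rw [mem_USmall_iff]
  refine and_congr_right fun _ => exists_congr fun D => and_congr_left ?_
  rintro ⟨r, hr⟩
  have := D.finNode
  have : Nonempty D.Node := ⟨r⟩
  have hbdd : BddAbove (Set.range fun x => (D.bag x).ncard) := (Set.finite_range _).bddAbove
  -- The boundary bag has exactly `t` elements, so the width is at least `t - 1`; it equals `t - 1`
  -- iff no bag exceeds `t`.
  have hrt : (D.bag r).ncard = t := by
    rw [hr, BHypergraph.boundary, Set.ncard_range_of_injective H.lab.injective, Nat.card_fin]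
  have hw : D.width = (t : ℤ) - 1 ↔ ⨆ x, (D.bag x).ncard = t := by
    unfold TreeDecomposition.width
    omega
  rw [hw]
  constructor
  · rintro h x
    exact (le_ciSup hbdd x).trans h.le
  · intro h
    exact le_antisymm (ciSup_le h) (hrt.symm.le.trans (le_ciSup hbdd r))

end IncidenceGraph

/-! ### Finite index from finitely many keys -/

section Index

variable {t : ℕ}

theorem finite_quotient_of_key {X : Type*} {κ : Type*} [Finite κ] (s : Setoid X) (key : X → κ)
    (h : ∀ x y, key x = key y → s.r x y) : Finite (Quotient s) := by
  refine Finite.of_injective (fun q : Quotient s => key q.out) fun q q' hq => ?_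
  rw [← q.out_eq, ← q'.out_eq]
  exact Quotient.sound (h _ _ hq)

/-- The congruence of `boundaryBagPart P` has finite index if the hypergraphs whose incidence graph
is in the small universe can be distinguished by finitely many keys. -/
theorem finite_quotient_hypergraphCongruence {κ : Type*} [Finite κ] {P : Set (BHypergraph t)}
    (key : (H : BHypergraph t) → H.coloredIncidenceGraph ∈ USmall t → κ)
    (hkey : ∀ (H₁ H₂ : BHypergraph t) (g₁ : H₁.coloredIncidenceGraph ∈ USmall t)
      (g₂ : H₂.coloredIncidenceGraph ∈ USmall t), key H₁ g₁ = key H₂ g₂ →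
      ∀ (Y : BHypergraph t) (_ : Y.coloredIncidenceGraph ∈ USmall t) (h₁ : H₁.Gluable Y)
        (h₂ : H₂.Gluable Y), (H₁.glue Y h₁ ∈ P ↔ H₂.glue Y h₂ ∈ P)) :
    Finite (Quotient (hypergraphCongruence (boundaryBagPart P) (HLarge t))) := by
  classical
  -- The label pattern secures gluability. The value `none` collects the hypergraphs outside the
  -- small universe, for which no gluing lies in `boundaryBagPart P`.
  refine finite_quotient_of_key (κ := (Fin t → Bool) × Option κ) _
    (fun H => (fun j => (H.1.lab j).isLeft,
      if hH : H.1.coloredIncidenceGraph ∈ USmall t then some (key H.1 hH) else none)) ?_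
  rintro ⟨H₁, _⟩ ⟨H₂, _⟩ h
  obtain ⟨hpat, hk⟩ := Prod.ext_iff.1 h
  refine ⟨fun j => congrFun hpat j, fun Y _ h₁ h₂ => ?_⟩
  simp only at hk h₁ h₂ ⊢
  rw [mem_boundaryBagPart_iff, mem_boundaryBagPart_iff, mem_USmall_glue_iff, mem_USmall_glue_iff]
  split_ifs at hk with g₁ g₂ g₂
  · have := hkey H₁ H₂ g₁ g₂ (Option.some_injective _ hk) Y
    constructor
    · rintro ⟨hP, -, gY⟩
      exact ⟨(this gY h₁ h₂).1 hP, g₂, gY⟩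
    · rintro ⟨hP, -, gY⟩
      exact ⟨(this gY h₁ h₂).2 hP, g₁, gY⟩
  · simp [g₁, g₂]

variable {P : Set (BHypergraph t)} {F : Set (BGraph t)}

/-- Generator-totality includes closure under renaming, since isomorphic graphs represent the same
hypergraph up to names. -/
theorem mem_of_labeledIso (hF : F ⊆ WCSmall t) (hT : GeneratorTotal F) {G G' : BGraph t}
    (hG : G ∈ F) (h : G.LabeledIso G') : G' ∈ F := by
  obtain ⟨hU, hW⟩ := hF hG
  refine hT G' ⟨mem_USmall_of_iso hU h, ?_⟩ ⟨G, hG, h.toHypergraph⟩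
  obtain ⟨f, hc, -⟩ := h.symm
  intro v w hvw
  rw [← hc v, ← hc w]
  exact hW _ _ (f.map_rel_iff.2 hvw)

/-- A small incidence graph is itself a well-colored generator of its hypergraph, so totality
transfers membership from `P` to `F`. -/
theorem coloredIncidenceGraph_mem_iff (hT : GeneratorTotal F)
    (hFP : hypergraphsOf F = P ∩ HSmall t) {H : BHypergraph t}
    (hH : H.coloredIncidenceGraph ∈ USmall t) : H.coloredIncidenceGraph ∈ F ↔ H ∈ P := by
  have hiso := labeledIso_toHypergraph_coloredIncidenceGraph H
  have hWC : H.coloredIncidenceGraph ∈ WCSmall t := ⟨hH, wellColored_coloredIncidenceGraph H⟩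
  constructor
  · intro h
    have : H ∈ hypergraphsOf F := ⟨_, h, hiso.symm⟩
    exact (hFP ▸ this).1
  · intro h
    have : H ∈ P ∩ HSmall t := ⟨h, _, hWC, hiso.symm⟩
    rw [← hFP] at this
    obtain ⟨G, hG, hGH⟩ := this
    exact hT _ hWC ⟨G, hG, hGH.trans hiso⟩

/-- For small hypergraphs the class of the incidence graph serves as key: testing with `Y` amounts
to testing with the incidence graph of `Y`. -/
theorem infiniteIndex_graphCongruence
    (hinf : InfiniteIndex (hypergraphCongruence (boundaryBagPart P) (HLarge t)))
    (hF : F ⊆ WCSmall t) (hT : GeneratorTotal F) (hFP : hypergraphsOf F = P ∩ HSmall t) :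
    InfiniteIndex (graphCongruence F (USmall t)) := by
  by_contra hfin
  have : Finite (Quotient (graphCongruence F (USmall t))) := not_infinite_iff_finite.1 hfin
  refine not_finite_iff_infinite.2 hinf (finite_quotient_hypergraphCongruence
    (fun H hH => Quotient.mk (graphCongruence F (USmall t)) ⟨H.coloredIncidenceGraph, hH⟩) ?_)
  intro H₁ H₂ g₁ g₂ hk Y gY h₁ h₂
  have hrel := (Quotient.exact hk).2 _ gY h₁.colorCompatible h₂.colorCompatible
  have key : ∀ (H : BHypergraph t) (_ : H.coloredIncidenceGraph ∈ USmall t) (h : H.Gluable Y),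
      H.coloredIncidenceGraph.glue Y.coloredIncidenceGraph h.colorCompatible ∈ F ↔
        H.glue Y h ∈ P := fun H g h => by
    rw [← coloredIncidenceGraph_mem_iff hT hFP ((mem_USmall_glue_iff h).2 ⟨g, gY⟩)]
    have hiso := glue_coloredIncidenceGraph_iso h
    exact ⟨fun hG => mem_of_labeledIso hF hT hG hiso,
      fun hG => mem_of_labeledIso hF hT hG hiso.symm⟩
  rw [← key H₁ g₁ h₁, ← key H₂ g₂ h₂]
  exact hrel

/-- The key is the color pattern of the boundary together with the state on one chosen parse tree.
Acceptance of any parse tree depends only on the graph, and the state after a `glue` node only on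
the states below it. -/
theorem finite_index_of_recognizes (hF : F ⊆ WCSmall t) (hT : GeneratorTotal F)
    {A : TreeAutomaton (Op t)} (hA : A.Recognizes {T | ∃ G ∈ F, Generates T G}) :
    Finite (Quotient (graphCongruence F (USmall t))) := by
  have := A.finQ
  have hacc : ∀ (T : BinTree (Op t)) (G : BGraph t), Generates T G → (A.Accepts T ↔ G ∈ F) :=
    fun T G h => (hA T).trans ⟨fun ⟨_, hG', h'⟩ => mem_of_labeledIso hF hT hG' (h'.iso h),
      fun hG => ⟨G, hG, h⟩⟩
  refine finite_quotient_of_key (κ := (Fin t → Prop) × A.Q) _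
    (fun G => (fun j => G.1.color (G.1.lab j) = Color.vert, A.run G.2.choose)) ?_
  rintro ⟨G₁, g₁⟩ ⟨G₂, g₂⟩ h
  obtain ⟨hpat, hrun⟩ := Prod.ext_iff.1 h
  refine ⟨fun j => ?_, ?_⟩
  · have hj := congrFun hpat j
    simp only [eq_iff_iff] at hj ⊢
    cases h₁ : G₁.color (G₁.lab j) <;> cases h₂ : G₂.color (G₂.lab j) <;> simp_all
  · rintro Y ⟨T, hT⟩ h₁ h₂
    rw [← hacc _ _ (g₁.choose_spec.glue hT h₁), ← hacc _ _ (g₂.choose_spec.glue hT h₂)]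
    simp only at hrun
    simp only [TreeAutomaton.Accepts, TreeAutomaton.run, hrun]

/-- The state on a chosen parse tree of the incidence graph is the key, since a `glue` node over
parse trees of two incidence graphs generates the incidence graph of the glued hypergraph. -/
theorem finite_index_of_decides {A : TreeAutomaton (Op t)} (hA : A.Decides P) :
    Finite (Quotient (hypergraphCongruence (boundaryBagPart P) (HLarge t))) := by
  have := A.finQ
  refine finite_quotient_hypergraphCongruence (fun H hH => A.run hH.choose) ?_
  rintro H₁ H₂ g₁ g₂ hrun Y ⟨T, hT⟩ h₁ h₂
  rw [← hA _ _ ((g₁.choose_spec.glue hT h₁.colorCompatible).of_iso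
      (glue_coloredIncidenceGraph_iso h₁)),
    ← hA _ _ ((g₂.choose_spec.glue hT h₂.colorCompatible).of_iso
      (glue_coloredIncidenceGraph_iso h₂))]
  simp only [TreeAutomaton.Accepts, TreeAutomaton.run, hrun]

end Index

end BoundariedHypergraphs

theorem mainTheorem7 (t : ℕ) (P : Set (BHypergraph t)) (hP : BHypergraph.IsoClosed P)
    (hinf : InfiniteIndex (hypergraphCongruence (boundaryBagPart P) (HLarge t))) :
    (∀ F : Set (BGraph t), F ⊆ WCSmall t → GeneratorTotal F →
      hypergraphsOf F = P ∩ HSmall t →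
        InfiniteIndex (graphCongruence F (USmall t)) ∧
        ¬ ∃ A : TreeAutomaton (Op t), A.Recognizes {T | ∃ G ∈ F, Generates T G}) ∧
    ¬ ∃ A : TreeAutomaton (Op t), A.Decides P := by
  refine ⟨fun F hF hT hFP => ?_, ?_⟩
  · have hinfF := infiniteIndex_graphCongruence hinf hF hT hFP
    refine ⟨hinfF, ?_⟩
    rintro ⟨A, hA⟩
    exact not_finite_iff_infinite.2 hinfF (finite_index_of_recognizes hF hT hA)
  · rintro ⟨A, hA⟩
    exact not_finite_iff_infinite.2 hinf (finite_index_of_decides hA)
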